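/- Let $N\ge 4$. Let $\Sigma$ be a smooth manifold of dimension $N-1$, let $\mathcal V_\Sigma\to\Sigma$ be a smooth vector bundle of rank $N$ with a smooth fibre metric $\eta$ of signature $(N-1,1)$, and let $e\colon T\Sigma\to\mathcal V_\Sigma$ be a smooth fibrewise injective bundle map (the restriction of a coframe to the boundary). Assume that $g^\partial=\eta(e,e)$ is degenerate at every point, and let $X,Y^1,\dots,Y^{N-2}$ be a smooth frame of $T\Sigma$ with $\iota_X g^\partial=0$. Write $\Omega_\partial^{i,j}=\Omega^i(\Sigma,\bigwedge^j\mathcal V_\Sigma)$. Let $\beta\in\Omega_\partial^{1,0}$ satisfy $\iota_X\beta=1$ and, with $\widetilde e:=e-\beta\,\iota_Xe$, $$\iota_{Y^1}\cdots\iota_{Y^{N-2}}(\widetilde e\wedge e^{N-4}\wedge v)=0\quad\text{for all } v \text{ of bidegree } (1,2) \text{ with } e^{N-3}\wedge v=0 .$$ Put $\widetilde g^\partial=\eta(\widetilde e,\widetilde e)$, let $W_1^{\partial,(N-3,N-1)}(\tau)=\tau\wedge e$, let $\widetilde\varrho^{(N-3,N-1)}(\tau)=[\tau,\widetilde e]\in\Omega_\partial^{N-2,N-2}$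 (contract the last internal index of $\tau$ with $\widetilde e$ by means of $\eta$ and antisymmetrise the form indices), and let $$\mathcal S=\operatorname{Ker}W_1^{\partial,(N-3,N-1)}\cap\operatorname{Ker}\widetilde\varrho^{(N-3,N-1)}\subset\Omega_\partial^{N-3,N-1}.$$ (1) $\mathcal S$ is locally free of rank $\frac{N(N-3)}2$ over $C^\infty$, and the space of solutions of its (pointwise, algebraic) defining equations has dimension $\frac{N(N-3)}2$ at every point. (2) For each $N$ there are functions $f_{\mu_1\mu_2}$ ($1\le\mu_1<\mu_2\le N-2$) of a matrix and of further real variables, linear in the latter, such that the following holds for all data as above. Let $x^1,\dots,x^{N-1}$ be local coordinates on $\Sigma$ and let $q$ be a point of their domain at which $\partial_{N-1}$ lies in the kernel of $g^\partial$ (for instance the centre of normal coordinates, where $g^\partial=\mathrm{diag}(1,\dots,1,0)$; or any point of the domain, if the coordinates are chosen such that $\partial_{N-1}$ is null throughout). Let $e_i=e(\partial_i)$ for $i\le N-1$ and complete $e_1,\dots,e_{N-1}$ to a basis of $\mathcal V_\Sigma$ at $q$ by a vector $e_N$ that is $\eta$-orthogonal to the image of $\widetilde e$. Then an element $\tau$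 of bidegree $(N-3,N-1)$ at $q$ satisfies the defining equations of $\mathcal S$ if and only if all its components with respect to the coordinates and this basis vanish, except possibly (up to the order of the antisymmetric indices) $$Y_\mu=\tau^{N\,N-1\,\mu_1\dots\mu_{N-3}}_{\mu_1\dots\mu_{N-3}}\ \ (\{\mu_1,\dots,\mu_{N-3}\}=\{1,\dots,N-2\}\setminus\{\mu\}),\qquad X_{\mu_1}^{\mu_2}=\tau^{N\,N-1\,\mu_3\dots\mu_{N-2}\,\mu_2}_{\mu_3\dots\mu_{N-2}\,\mu_1}\ \ (\{\mu_1,\dots,\mu_{N-2}\}=\{1,\dots,N-2\}),$$ and $$\sum_{\mu=1}^{N-2}Y_\mu=0,\qquad X_{\mu_1}^{\mu_2}=f_{\mu_1\mu_2}\bigl(\widetilde g^\partial,\ (X_{\nu_2}^{\nu_1})_{\nu_1<\nu_2},\ (Y_\nu)_\nu\bigr)\quad\text{for all }\mu_1<\mu_2,$$ where $\widetilde g^\partial$ denotes the matrix $\widetilde g^\partial(\partial_i,\partial_j)$ at $q$. In particular all this holds at $q$ for the components of every $\tau\in\mathcal S$. -/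

import Mathlib

open Bundle Module
open scoped Manifold ContDiff

noncomputable section

/-! ### Linear algebra on one fibre

`T` plays the role of a tangent space of the boundary, `V` that of a fibre of the internal bundle. -/

section Fibre

/-- `⋀ⁱ T* ⊗ ⋀ʲ V` (for finite-dimensional `V`): alternating `i`-forms on `T` with values in `⋀ʲ V`,
where `⋀ʲ V` is realised as the space of alternating `j`-forms on the dual space `V*`. Thus
`τ u ξ` is the value of `τ` on the vectors `u₁, …, uᵢ` and the covectors `ξ₁, …, ξⱼ`. -/
abbrev BiForm (T V : Type*) [AddCommGroup T] [Module ℝ T] [AddCommGroup V] [Module ℝ V]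
    (i j : ℕ) : Type _ :=
  T [⋀^Fin i]→ₗ[ℝ] (Dual ℝ V [⋀^Fin j]→ₗ[ℝ] ℝ)

variable {T V : Type*} [AddCommGroup T] [Module ℝ T] [AddCommGroup V] [Module ℝ V]

/-- Exterior product of the internal parts, `⋀ʲ V ⊗ ⋀ˡ V → ⋀ʲ⁺ˡ V`. -/
def internalWedge (j l : ℕ) :
    TensorProduct ℝ (Dual ℝ V [⋀^Fin j]→ₗ[ℝ] ℝ) (Dual ℝ V [⋀^Fin l]→ₗ[ℝ] ℝ) →ₗ[ℝ]
      (Dual ℝ V [⋀^Fin (j + l)]→ₗ[ℝ] ℝ) :=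
  (AlternatingMap.domDomCongrₗ ℝ finSumFinEquiv).toLinearMap ∘ₗ
    (LinearMap.mul' ℝ ℝ).compAlternatingMapₗ ℝ ∘ₗ AlternatingMap.domCoprod'

/-- Exterior product on both the external and the internal parts (each one a sum over shuffles).
The sign `(-1) ^ (j k)` implements graded commutativity with respect to the total degree:
`a b = (-1) ^ ((i + j) (k + l)) b a`. -/
def wedge {i j k l : ℕ} (a : BiForm T V i j) (b : BiForm T V k l) : BiForm T V (i + k) (j + l) :=
  (-1 : ℝ) ^ (j * k) •
    ((internalWedge j l).compAlternatingMap (a.domCoprod b)).domDomCongr finSumFinEquiv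

theorem wedge_add_left {i j k l : ℕ} (a a' : BiForm T V i j) (b : BiForm T V k l) :
    wedge (a + a') b = wedge a b + wedge a' b := by
  have h : (a + a').domCoprod b = a.domCoprod b + a'.domCoprod b := by
    simp only [← AlternatingMap.domCoprod'_apply, TensorProduct.add_tmul, map_add]
  unfold wedge
  rw [h, ← smul_add]
  congr 1
  ext
  simp

theorem wedge_smul_left {i j k l : ℕ} (c : ℝ) (a : BiForm T V i j) (b : BiForm T V k l) :
    wedge (c • a) b = c • wedge a b := by
  have h : (c • a).domCoprod b = c • a.domCoprod b := by
    simp only [← AlternatingMap.domCoprod'_apply, ← TensorProduct.smul_tmul', map_smul]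
  unfold wedge
  rw [h, smul_comm c]
  congr 1
  ext
  simp

/-- A linear map `e : T → V` as an element of `T* ⊗ V = ⋀¹ T* ⊗ ⋀¹ V`. -/
def oneOneForm (e : T →ₗ[ℝ] V) : BiForm T V 1 1 where
  toFun u := AlternatingMap.ofSubsingleton ℝ (Dual ℝ V) ℝ 0 (Dual.eval ℝ V (e (u 0)))
  map_update_add' u a x y := by
    obtain rfl := Subsingleton.elim a 0
    ext ξ
    simp
  map_update_smul' u a c x := by
    obtain rfl := Subsingleton.elim a 0
    ext ξ
    simp
  map_eq_zero_of_eq' u a b _ hab := absurd (Subsingleton.elim a b) hab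

/-- The wedge power `eᵏ = e ∧ ⋯ ∧ e`, an element of `⋀ᵏ T* ⊗ ⋀ᵏ V`. -/
def coframePow (e : T →ₗ[ℝ] V) : (k : ℕ) → BiForm T V k k
  | 0 => AlternatingMap.constOfIsEmpty ℝ T (Fin 0)
      (AlternatingMap.constOfIsEmpty ℝ (Dual ℝ V) (Fin 0) (1 : ℝ))
  | k + 1 => wedge (coframePow e k) (oneOneForm e)

/-- The map `W_k^{(i,j)} : X ↦ X ∧ eᵏ`. -/
def wedgePowMap (e : T →ₗ[ℝ] V) (k i j : ℕ) : BiForm T V i j →ₗ[ℝ] BiForm T V (i + k) (j + k) where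
  toFun X := wedge X (coframePow e k)
  map_add' X Y := wedge_add_left X Y _
  map_smul' c X := wedge_smul_left c X _

/-- For a metric `η` on `V` and `e : T → V`, the map `ϱ^{(i,j+1)} : X ↦ [X, e]`,
`[X, e]_{μ₁…μᵢ₊₁}^{a₁…aⱼ} = ∑_k ± X_{… μ̂_k …}^{a₁…aⱼ b} η_{bc} e^c_{μ_k}`:
the last internal index of `X` is lowered by `η` and contracted with `e`, and the external indices
are antisymmetrised. (The sum over all permutations of the external indices is `i!` times
this sum over cyclic shuffles. The sign `(-1) ^ (i + j)` moves the contracted internal index of `X`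
and the external index of `e` from the first to the last position.) -/
def bracketMap (η : V →ₗ[ℝ] Dual ℝ V) (e : T →ₗ[ℝ] V) (i j : ℕ) :
    BiForm T V i (j + 1) →ₗ[ℝ] BiForm T V (i + 1) j where
  toFun X := (-1 : ℝ) ^ (i + j) • AlternatingMap.alternatizeUncurryFin
    { toFun := fun u =>
        (AlternatingMap.curryLeftLinearMap.flip (η (e u))).compAlternatingMap X
      map_add' := fun u v => by ext; simp
      map_smul' := fun c u => by ext; simp }
  map_add' X Y := by
    rw [← smul_add, ← AlternatingMap.alternatizeUncurryFin_add]
    congr 2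
  map_smul' c X := by
    rw [RingHom.id_apply, smul_comm c]
    congr 1
    rw [← AlternatingMap.alternatizeUncurryFin_smul]
    congr 1

/-- The fibre of `𝒮` for space-time dimension `N = n + 4`: the elements `τ` of `⋀ᴺ⁻³ T* ⊗ ⋀ᴺ⁻¹ V`
with `τ ∧ e = 0` and `[τ, ẽ] = 0`. -/
def degeneracyFibre (n : ℕ) (η : V →ₗ[ℝ] Dual ℝ V) (e e' : T →ₗ[ℝ] V) :
    Submodule ℝ (BiForm T V (n + 1) (n + 3)) :=
  LinearMap.ker (wedgePowMap e 1 (n + 1) (n + 3)) ⊓ LinearMap.ker (bracketMap η e' (n + 1) (n + 2))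

/-- The component `τ_{I₁…Iᵢ}^{J₁…Jⱼ}` with respect to vectors `∂_μ` of `T` and a basis
`b` of `V`. -/
def component {ι κ : Type*} {i j : ℕ} (d : ι → T) (b : Basis κ ℝ V) (τ : BiForm T V i j)
    (I : Fin i → ι) (J : Fin j → κ) : ℝ :=
  τ (fun k => d (I k)) (fun k => b.coord (J k))

/-- The lower indices of `X_μ^ν` and of `Y_ν`: the increasing sequence of all elements of
`{1, …, N-2} ∖ {ν}`, where `{1, …, N-2}` is the initial part of `{1, …, N-1}`. -/
def lowerIndices {n : ℕ} (ν : Fin (n + 2)) : Fin (n + 1) → Fin (n + 3) :=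
  fun k => (ν.succAbove k).castSucc

/-- The upper indices of `X_μ^ν` (and of `Y_ν`, for `μ = ν`): first `N`, then `N-1`, then the lower
indices of `X_μ^ν` with `ν` in the place of `μ`. -/
def upperIndices {n : ℕ} (μ ν : Fin (n + 2)) : Fin (n + 3) → Fin (n + 4) :=
  Fin.cons (Fin.last (n + 3)) (Fin.cons (Fin.last (n + 2)).castSucc
    (fun k : Fin (n + 1) => (Equiv.swap μ ν (ν.succAbove k)).castSucc.castSucc))

/-- `X_μ^ν = τ^{N N-1 μ₃ … μ_{N-2} ν}_{μ₃ … μ_{N-2} μ}`, where `μ, ν, μ₃, …, μ_{N-2}` are the numbers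
`1, …, N-2` in some order. (A permutation applied to the indices `μ₃ … μ_{N-2} μ` and to
the indices `μ₃ … μ_{N-2} ν` simultaneously does not change the component.) -/
def compX {n : ℕ} (d : Fin (n + 3) → T) (b : Basis (Fin (n + 4)) ℝ V)
    (τ : BiForm T V (n + 1) (n + 3)) (μ ν : Fin (n + 2)) : ℝ :=
  component d b τ (lowerIndices ν) (upperIndices μ ν)

/-- `Y_μ = τ^{N N-1 μ₁ … μ_{N-3}}_{μ₁ … μ_{N-3}}`, where `{μ₁, …, μ_{N-3}} = {1, …, N-2} ∖ {μ}`. -/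
def compY {n : ℕ} (d : Fin (n + 3) → T) (b : Basis (Fin (n + 4)) ℝ V)
    (τ : BiForm T V (n + 1) (n + 3)) (μ : Fin (n + 2)) : ℝ :=
  component d b τ (lowerIndices μ) (upperIndices μ μ)

/-- The component with lower indices `I` and upper indices `J` is, up to the order of the lower and
of the upper indices, one of the components `Y_μ` or `X_μ^ν`, `μ ≠ ν`. -/
def IsXYIndex {n : ℕ} (I : Fin (n + 1) → Fin (n + 3)) (J : Fin (n + 3) → Fin (n + 4)) : Prop :=
  ∃ (μ ν : Fin (n + 2)) (σ : Equiv.Perm (Fin (n + 1))) (ρ : Equiv.Perm (Fin (n + 3))),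
    I = lowerIndices ν ∘ σ ∧ J = upperIndices μ ν ∘ ρ

end Fibre

/-! ### Fields on the boundary

`M` is the boundary, a smooth manifold of dimension `N - 1 = n + 3`, and `E` the restriction to `M`
of the internal bundle, a smooth vector bundle of rank `N = n + 4`. -/

section Fields

/-- A Lorentzian metric on the vector bundle `E` and a smooth bundle map `e : TM → E`, injective on
each fibre (the restriction to the boundary of a coframe). -/
structure BoundaryCoframe (n : ℕ) (M : Type*) [TopologicalSpace M]
    [ChartedSpace (EuclideanSpace ℝ (Fin (n + 3))) M] [IsManifold (𝓡 (n + 3)) ∞ M]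
    (F : Type*) [NormedAddCommGroup F] [NormedSpace ℝ F]
    (E : M → Type*) [TopologicalSpace (TotalSpace F E)] [∀ x, AddCommGroup (E x)]
    [∀ x, Module ℝ (E x)] [∀ x, TopologicalSpace (E x)] [∀ x, IsTopologicalAddGroup (E x)]
    [∀ x, ContinuousSMul ℝ (E x)] [FiberBundle F E] [VectorBundle ℝ F E]
    [ContMDiffVectorBundle ∞ F E (𝓡 (n + 3))] where
  /-- the fibre metric `η` -/
  metric (x : M) : E x →L[ℝ] E x →L[ℝ] ℝ
  /-- `η` is symmetric of signature `(N - 1, 1)`: there is an orthonormal basis. -/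
  metric_lorentzian (x : M) : ∃ b : Basis (Fin (n + 4)) ℝ (E x), ∀ i j,
    metric x (b i) (b j) = if i = j then (if i = Fin.last (n + 3) then -1 else 1) else 0
  metric_smooth : ContMDiff (𝓡 (n + 3)) ((𝓡 (n + 3)).prod 𝓘(ℝ, F →L[ℝ] F →L[ℝ] ℝ)) ∞
    (fun x => TotalSpace.mk' (F →L[ℝ] F →L[ℝ] ℝ)
      (E := fun x => E x →L[ℝ] E x →L[ℝ] ℝ) x (metric x))
  /-- the coframe `e` -/
  coframe (x : M) : TangentSpace (𝓡 (n + 3)) x →L[ℝ] E x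
  coframe_injective (x : M) : Function.Injective (coframe x)
  coframe_smooth : ContMDiff (𝓡 (n + 3))
    ((𝓡 (n + 3)).prod 𝓘(ℝ, EuclideanSpace ℝ (Fin (n + 3)) →L[ℝ] F)) ∞
    (fun x => TotalSpace.mk' (EuclideanSpace ℝ (Fin (n + 3)) →L[ℝ] F)
      (E := fun x => TangentSpace (𝓡 (n + 3)) x →L[ℝ] E x) x (coframe x))

variable {n : ℕ} {M : Type*} [TopologicalSpace M]
  [ChartedSpace (EuclideanSpace ℝ (Fin (n + 3))) M] [IsManifold (𝓡 (n + 3)) ∞ M]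
  {F : Type*} [NormedAddCommGroup F] [NormedSpace ℝ F]
  {E : M → Type*} [TopologicalSpace (TotalSpace F E)] [∀ x, AddCommGroup (E x)]
  [∀ x, Module ℝ (E x)] [∀ x, TopologicalSpace (E x)] [∀ x, IsTopologicalAddGroup (E x)]
  [∀ x, ContinuousSMul ℝ (E x)] [FiberBundle F E] [VectorBundle ℝ F E]
  [ContMDiffVectorBundle ∞ F E (𝓡 (n + 3))]

namespace BoundaryCoframe

/-- The fibre metric as a linear map `E x → (E x)*`. -/
def metricL (D : BoundaryCoframe n M F E) (x : M) : E x →ₗ[ℝ] Dual ℝ (E x) where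
  toFun v := (D.metric x v : E x →ₗ[ℝ] ℝ)
  map_add' v w := by simp
  map_smul' c v := by simp

/-- The coframe at `x` as a linear map. -/
def coframeL (D : BoundaryCoframe n M F E) (x : M) : TangentSpace (𝓡 (n + 3)) x →ₗ[ℝ] E x :=
  (D.coframe x : TangentSpace (𝓡 (n + 3)) x →ₗ[ℝ] E x)

/-- `g^∂(u, v) = η(e u, e v)`. -/
def boundaryMetric (D : BoundaryCoframe n M F E) (x : M) (u v : TangentSpace (𝓡 (n + 3)) x) : ℝ :=
  D.metric x (D.coframe x u) (D.coframe x v)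

/-- `u` lies in the kernel of the degenerate boundary metric `g^∂`. -/
def IsNull (D : BoundaryCoframe n M F E) (x : M) (u : TangentSpace (𝓡 (n + 3)) x) : Prop :=
  ∀ v, D.boundaryMetric x u v = 0

end BoundaryCoframe

variable (n M) in
/-- A smooth vector field on `M`. -/
def IsSmoothFieldOn (U : Set M) (Z : ∀ x : M, TangentSpace (𝓡 (n + 3)) x) : Prop :=
  ContMDiffOn (𝓡 (n + 3)) (𝓡 (n + 3)).tangent ∞
    (fun x => (TotalSpace.mk' (EuclideanSpace ℝ (Fin (n + 3))) x (Z x) :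
      TangentBundle (𝓡 (n + 3)) M)) U

variable (n F) in
/-- A smooth section over `U` of the dual bundle `E*`. -/
def IsSmoothCovectorOn (U : Set M) (α : ∀ x : M, E x →L[ℝ] ℝ) : Prop :=
  ContMDiffOn (𝓡 (n + 3)) ((𝓡 (n + 3)).prod 𝓘(ℝ, F →L[ℝ] ℝ)) ∞
    (fun x => TotalSpace.mk' (F →L[ℝ] ℝ)
      (E := fun x => E x →L[ℝ] Bundle.Trivial M ℝ x) x (α x)) U

variable (n F) in
/-- Elements of `Ω_∂^{i,j} = Ωⁱ(M, ⋀ʲ E)`: `τ` is smooth if its values on all smooth local vector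
fields and all smooth local sections of `E*` are smooth functions. -/
def IsSmoothBiForm {i j : ℕ} (τ : ∀ x : M, BiForm (TangentSpace (𝓡 (n + 3)) x) (E x) i j) : Prop :=
  ∀ U : Set M, IsOpen U →
    ∀ Z : Fin i → ∀ x : M, TangentSpace (𝓡 (n + 3)) x, (∀ a, IsSmoothFieldOn n M U (Z a)) →
      ∀ α : Fin j → ∀ x : M, E x →L[ℝ] ℝ, (∀ c, IsSmoothCovectorOn n F U (α c)) →
        ContMDiffOn (𝓡 (n + 3)) 𝓘(ℝ, ℝ) ∞
          (fun x => τ x (fun a => Z a x) (fun c => (α c x : E x →ₗ[ℝ] ℝ))) U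

variable (n M) in
/-- A smooth one-form on `M`. -/
def IsSmoothOneForm (β : ∀ x : M, TangentSpace (𝓡 (n + 3)) x →L[ℝ] ℝ) : Prop :=
  ContMDiff (𝓡 (n + 3))
    ((𝓡 (n + 3)).prod 𝓘(ℝ, EuclideanSpace ℝ (Fin (n + 3)) →L[ℝ] ℝ)) ∞
    (fun x => TotalSpace.mk' (EuclideanSpace ℝ (Fin (n + 3)) →L[ℝ] ℝ)
      (E := fun x => TangentSpace (𝓡 (n + 3)) x →L[ℝ] Bundle.Trivial M ℝ x) x (β x))

/-- A smooth frame `X, Y₁, …, Y_{N-2}` of `TM` such that `X` spans the kernel of the boundary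
metric at every point; in particular the boundary is light-like. (By the Lorentzian
signature, the kernel is one-dimensional as soon as it is nonzero.) -/
structure NullFrame (D : BoundaryCoframe n M F E) where
  X (x : M) : TangentSpace (𝓡 (n + 3)) x
  Y (i : Fin (n + 2)) (x : M) : TangentSpace (𝓡 (n + 3)) x
  X_smooth : IsSmoothFieldOn n M Set.univ X
  Y_smooth (i : Fin (n + 2)) : IsSmoothFieldOn n M Set.univ (Y i)
  X_null (x : M) : D.IsNull x (X x)
  frame (x : M) : LinearIndependent ℝ
    (Fin.cons (X x) (fun i => Y i x) : Fin (n + 3) → TangentSpace (𝓡 (n + 3)) x)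

namespace NullFrame

variable {D : BoundaryCoframe n M F E}

/-- `ẽ = e - ê`, where `ê = β ⊗ ι_X e`. -/
def modifiedCoframe (R : NullFrame D) (β : ∀ x : M, TangentSpace (𝓡 (n + 3)) x →L[ℝ] ℝ) (x : M) :
    TangentSpace (𝓡 (n + 3)) x →ₗ[ℝ] E x :=
  D.coframeL x - (β x : TangentSpace (𝓡 (n + 3)) x →ₗ[ℝ] ℝ).smulRight (D.coframeL x (R.X x))

/-- The conditions that fix the one-form `β`: it is smooth, `ι_X β = 1`, and
`ι_{Y₁} ⋯ ι_{Y_{N-2}} (ẽ ∧ e^{N-4} ∧ v) = 0` for all `v` of bidegree `(1, 2)` with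
`e^{N-3} ∧ v = 0`. (The condition on `v` is algebraic, hence stated fibre by fibre.) -/
structure IsNormalising (R : NullFrame D)
    (β : ∀ x : M, TangentSpace (𝓡 (n + 3)) x →L[ℝ] ℝ) : Prop where
  smooth : IsSmoothOneForm n M β
  apply_X (x : M) : β x (R.X x) = 1
  apply_Y (x : M) (v : BiForm (TangentSpace (𝓡 (n + 3)) x) (E x) 1 2) :
    wedge (coframePow (D.coframeL x) (n + 1)) v = 0 →
      wedge (wedge (oneOneForm (R.modifiedCoframe β x)) (coframePow (D.coframeL x) n)) v
        (fun k => R.Y (Fin.cast (by omega) k) x) = 0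

/-- The modified metric `g̃^∂ = η(ẽ, ẽ)`, as a matrix with respect to tangent vectors `∂_μ`. -/
def modifiedMetric (R : NullFrame D) (β : ∀ x : M, TangentSpace (𝓡 (n + 3)) x →L[ℝ] ℝ) (x : M)
    (d : Fin (n + 3) → TangentSpace (𝓡 (n + 3)) x) : Matrix (Fin (n + 3)) (Fin (n + 3)) ℝ :=
  Matrix.of fun i j => D.metric x (R.modifiedCoframe β x (d i)) (R.modifiedCoframe β x (d j))

/-- The fibre of `𝒮` at `x`. -/
def fibreS (R : NullFrame D) (β : ∀ x : M, TangentSpace (𝓡 (n + 3)) x →L[ℝ] ℝ) (x : M) :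
    Submodule ℝ (BiForm (TangentSpace (𝓡 (n + 3)) x) (E x) (n + 1) (n + 3)) :=
  degeneracyFibre n (D.metricL x) (D.coframeL x) (R.modifiedCoframe β x)

/-- `𝒮 = Ker W_1^{∂,(N-3,N-1)} ∩ Ker ϱ̃^{(N-3,N-1)} ⊂ Ω_∂^{N-3,N-1}`. -/
def spaceS (R : NullFrame D) (β : ∀ x : M, TangentSpace (𝓡 (n + 3)) x →L[ℝ] ℝ) :
    Set (∀ x : M, BiForm (TangentSpace (𝓡 (n + 3)) x) (E x) (n + 1) (n + 3)) :=
  {τ | IsSmoothBiForm n F τ ∧ ∀ x, τ x ∈ R.fibreS β x}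

end NullFrame

/-- A space `S` of smooth forms is locally free of rank `r` over the smooth functions: near every
point there are `r` elements of `S`, linearly independent at each point, such that every element of
`S` is locally a combination of them with smooth coefficients. -/
def IsLocallyFreeOfRank {i j : ℕ}
    (S : Set (∀ x : M, BiForm (TangentSpace (𝓡 (n + 3)) x) (E x) i j)) (r : ℕ) : Prop :=
  ∀ p : M, ∃ U : Set M, IsOpen U ∧ p ∈ U ∧
    ∃ σ : Fin r → ∀ x : M, BiForm (TangentSpace (𝓡 (n + 3)) x) (E x) i j,
      (∀ k, σ k ∈ S) ∧ (∀ x ∈ U, LinearIndependent ℝ (fun k => σ k x)) ∧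
      ∀ τ ∈ S, ∃ c : Fin r → M → ℝ, (∀ k, ContMDiffOn (𝓡 (n + 3)) 𝓘(ℝ, ℝ) ∞ (c k) U) ∧
        ∀ x ∈ U, τ x = ∑ k, c k x • σ k x

/-- The coordinate vector `∂_i` at `q` of a chart `φ`. -/
def coordVector (φ : OpenPartialHomeomorph M (EuclideanSpace ℝ (Fin (n + 3)))) (q : M)
    (i : Fin (n + 3)) : TangentSpace (𝓡 (n + 3)) q :=
  mfderiv 𝓘(ℝ, EuclideanSpace ℝ (Fin (n + 3))) (𝓡 (n + 3)) φ.symm (φ q)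
    (EuclideanSpace.single i (1 : ℝ))

end Fields

end

/-! Fix volume forms Ω on the tangent space T and W on V*. A form of bidegree (N-3, N-1) has
external codimension two and internal codimension one, so it can be written as τ = ∑ Ω(d_i, d_j, ·)
⊗ W(P_ij, ·), where P_ij is an antisymmetric array of covectors on V (`exists_sum_starForm`).
Cramer's rule turns the two defining equations into equations for P: τ ∧ e = 0 becomes ∑_j P_ij(e
d_j) = 0, and [τ, ẽ] = 0 becomes ∑_j P_ij ∧ η(ẽ d_j) = 0, for every i.

Take the basis d = (X, Y_1, …, Y_{N-2}). Since ẽ X = 0, only the covectors θ_ν = η(ẽ Y_ν) enter the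
second equation. They are independent because the boundary metric is definite transversally to X
(`IsLorentzian.gram_definite`). Cartan's lemma then gives P_ij = ∑_ν b_ijν θ_ν with b symmetric in
j, ν. If all three indices belong to the Y's, b is also antisymmetric in i, j, hence zero. What
remains is one symmetric matrix B, the coefficients of the P_0j up to a factor 2, and the first
equation reduces to tr(B G) = 0 with G the Gram matrix of the Y's. This is
`IsLightLike.mem_degeneracyFibre_iff`, and the dimension is (N-2)(N-1)/2 - 1 = N(N-3)/2.

For the rank over smooth functions, `tracelessBasis` is a basis of these matrices that depends
polynomially on G. Together with volume forms built from smooth sections it gives a smooth local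
frame. The coefficients of τ in it are values of τ on smooth fields divided by nonvanishing
functions (`NullFrame.localCoeff`).

For the components, the role of X is played by ∂_{N-1} and that of the Y's by the other ∂_μ. Because
e_N is orthogonal to the image of ẽ, θ_ν = ∑_a G_νa e^a in the dual basis, so up to signs and one
common factor the components of τ are the entries of A = B G. The trace condition reads ∑ Y_μ = 0,
and B is symmetric exactly when G A is. For definite G this symmetry determines one strict triangle
of A linearly from the other and the diagonal (`exists_triangular_completion`), because a strictly
triangular matrix that is self-adjoint for a definite form vanishes. -/

/-! ### Exterior products with a one-form. -/

section AlternatingForms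

open Matrix (vecCons)

variable {T N N₁ N₂ : Type*} [AddCommGroup T] [Module ℝ T] [AddCommGroup N] [Module ℝ N]
  [AddCommGroup N₁] [Module ℝ N₁] [AddCommGroup N₂] [Module ℝ N₂]

theorem MultilinearMap.alternatization_domDomCongr {ι : Type*} [Fintype ι] [DecidableEq ι]
    (m : MultilinearMap ℝ (fun _ : ι => T) N) (σ : Equiv.Perm ι) :
    MultilinearMap.alternatization (m.domDomCongr σ) =
      Equiv.Perm.sign σ • MultilinearMap.alternatization m := by
  ext v
  rw [AlternatingMap.smul_apply, MultilinearMap.alternatization_apply,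
    MultilinearMap.alternatization_apply, Finset.smul_sum]
  refine Fintype.sum_equiv (Equiv.mulRight σ) _ _ fun τ => ?_
  simp only [Equiv.coe_mulRight, map_mul, smul_smul, MultilinearMap.domDomCongr_apply,
    Equiv.Perm.mul_apply]
  rw [mul_comm, mul_assoc, Int.units_mul_self, mul_one]

/-- The cyclic permutation of `Fin i ⊕ Fin 1` that moves the last index to position `k`. -/
def cyclicShuffle (i : ℕ) (k : Fin (i + 1)) : Equiv.Perm (Fin i ⊕ Fin 1) :=
  (finSumFinEquiv.trans ((finRotate (i + 1)).trans k.cycleRange.symm)).trans finSumFinEquiv.symm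

theorem sign_cyclicShuffle (i : ℕ) (k : Fin (i + 1)) :
    Equiv.Perm.sign (cyclicShuffle i k) = (-1) ^ (i + (k : ℕ)) := by
  have h := Equiv.Perm.sign_symm_trans_trans
    ((finRotate (i + 1)).trans k.cycleRange.symm) (finSumFinEquiv (m := i) (n := 1)).symm
  rw [Equiv.symm_symm] at h
  have h' : cyclicShuffle i k = (finSumFinEquiv.trans
    ((finRotate (i + 1)).trans k.cycleRange.symm)).trans finSumFinEquiv.symm := rfl
  rw [h', h, Equiv.Perm.sign_trans, Equiv.Perm.sign_symm,
    Fin.sign_cycleRange, sign_finRotate, mul_comm, pow_add, Nat.add_sub_cancel]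

theorem finSumFinEquiv_cyclicShuffle_inl (i : ℕ) (k : Fin (i + 1)) (j : Fin i) :
    finSumFinEquiv (cyclicShuffle i k (Sum.inl j)) = k.succAbove j := by
  have : finRotate (i + 1) (Fin.castAdd 1 j) = j.succ := by
    rw [finRotate_apply]
    exact Fin.coeSucc_eq_succ
  simp [cyclicShuffle, this]

theorem finSumFinEquiv_cyclicShuffle_inr (i : ℕ) (k : Fin (i + 1)) (j : Fin 1) :
    finSumFinEquiv (cyclicShuffle i k (Sum.inr j)) = k := by
  have : finRotate (i + 1) (Fin.natAdd i j) = 0 := by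
    obtain rfl := Subsingleton.elim j 0
    exact finRotate_last
  simp [cyclicShuffle, this]

/-- The exterior product with a one-form is a sum over the cyclic shuffles. -/
theorem domCoprod_oneForm_apply {i : ℕ} (a : T [⋀^Fin i]→ₗ[ℝ] N₁) (b : T [⋀^Fin 1]→ₗ[ℝ] N₂)
    (u : Fin (i + 1) → T) :
    (a.domCoprod b).domDomCongr finSumFinEquiv u =
      ∑ k : Fin (i + 1), ((-1 : ℝ) ^ (i + (k : ℕ))) •
        TensorProduct.tmul ℝ (a (k.removeNth u)) (b fun _ => u k) := by
  have hupd : ∀ x z : T, Function.update (fun _ : Fin 1 => x) 0 z = fun _ => z := fun x z => by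
    ext j
    rw [Subsingleton.elim j 0, Function.update_self]
  let R : T [⋀^Fin (i + 1)]→ₗ[ℝ] TensorProduct ℝ N₁ N₂ :=
    (-1 : ℝ) ^ i • AlternatingMap.alternatizeUncurryFin
      { toFun := fun x => ((TensorProduct.mk ℝ N₁ N₂).flip (b fun _ => x)).compAlternatingMap a
        map_add' := fun x y => by
          have h := b.map_update_add (fun _ => x) 0 x y
          simp only [hupd] at h
          ext; simp [h]
        map_smul' := fun c x => by
          have h := b.map_update_smul (fun _ => x) 0 c x
          simp only [hupd] at h
          ext; simp [h] }
  have hR : ∀ u, R u = ∑ k : Fin (i + 1), ((-1 : ℝ) ^ (i + (k : ℕ))) •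
        TensorProduct.tmul ℝ (a (k.removeNth u)) (b fun _ => u k) := fun u => by
    simp only [R, AlternatingMap.smul_apply, AlternatingMap.alternatizeUncurryFin_apply,
      Finset.smul_sum]
    refine Finset.sum_congr rfl fun k _ => ?_
    simp [pow_add, smul_smul, ← Int.cast_smul_eq_zsmul ℝ]
  rw [← hR]
  let R' := R.domDomCongr (finSumFinEquiv (m := i) (n := 1)).symm
  -- Both sides are compared after alternatization. `R'` is already alternating, so it is multiplied
  -- by (i+1)!; written as a signed sum of i+1 permutations of the tensor product, it yields i+1
  -- copies of i! times the shuffle product.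
  have key : a.domCoprod b = R' := by
    let m0 : MultilinearMap ℝ (fun _ : Fin i ⊕ Fin 1 => T) (TensorProduct ℝ N₁ N₂) :=
      MultilinearMap.domCoprod (a : MultilinearMap ℝ _ N₁) (b : MultilinearMap ℝ _ N₂)
    have h1 : (R' : MultilinearMap ℝ _ _) =
        ∑ k : Fin (i + 1), Equiv.Perm.sign (cyclicShuffle i k) •
          m0.domDomCongr (cyclicShuffle i k) := by
      ext v
      have : (R' : MultilinearMap ℝ _ _) v = R (fun x => v (finSumFinEquiv.symm x)) := rfl
      rw [this, hR, sum_apply]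
      refine Finset.sum_congr rfl fun k _ => ?_
      have hl : ∀ j, cyclicShuffle i k (Sum.inl j) = finSumFinEquiv.symm (k.succAbove j) :=
        fun j => (Equiv.eq_symm_apply _).mpr (finSumFinEquiv_cyclicShuffle_inl i k j)
      have hr : ∀ j, cyclicShuffle i k (Sum.inr j) = finSumFinEquiv.symm k :=
        fun j => (Equiv.eq_symm_apply _).mpr (finSumFinEquiv_cyclicShuffle_inr i k j)
      have ha : a (k.removeNth fun x => v (finSumFinEquiv.symm x)) =
          a (fun j => v (cyclicShuffle i k (Sum.inl j))) :=
        congrArg a (funext fun j => by rw [hl]; rfl)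
      have hb : b (fun _ => v (finSumFinEquiv.symm k)) =
          b (fun j => v (cyclicShuffle i k (Sum.inr j))) :=
        congrArg b (funext fun j => by rw [hr])
      rw [smul_apply, sign_cyclicShuffle, MultilinearMap.domDomCongr_apply,
        MultilinearMap.domCoprod_apply, ha, hb, Units.smul_def, ← Int.cast_smul_eq_zsmul ℝ]
      push_cast
      rfl
    have h2 := congrArg MultilinearMap.alternatization h1
    rw [AlternatingMap.coe_alternatization, map_sum] at h2
    have h3 : ∀ k : Fin (i + 1), MultilinearMap.alternatization
        (Equiv.Perm.sign (cyclicShuffle i k) • m0.domDomCongr (cyclicShuffle i k)) =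
        (i.factorial * Nat.factorial 1) • a.domCoprod b := fun k => by
      have := MultilinearMap.domCoprod_alternization_eq (R' := ℝ) a b
      rw [Fintype.card_fin, Fintype.card_fin] at this
      rw [← this, Units.smul_def, map_zsmul, ← Units.smul_def,
        MultilinearMap.alternatization_domDomCongr, smul_smul, Int.units_mul_self, one_smul]
    simp only [h3, Finset.sum_const, Finset.card_univ, Fintype.card_sum, Fintype.card_fin,
      smul_smul] at h2
    rw [Nat.factorial_one, mul_one, ← Nat.factorial_succ] at h2
    have hne : ((i + 1).factorial : ℝ) ≠ 0 := by positivity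
    simp only [← Nat.cast_smul_eq_nsmul ℝ] at h2
    exact (smul_right_injective _ hne h2).symm
  rw [key]
  simp [R', Function.comp_assoc]

end AlternatingForms


/-! ### Contractions of a top-degree form. -/

section TopForms

open Matrix (vecCons)

theorem Fin.removeNth_succ_vecCons {T : Type*} {k : ℕ} (i : Fin (k + 1)) (x : T) (u : Fin (k + 1) → T) :
    i.succ.removeNth (vecCons x u) = vecCons x (i.removeNth u) := by
  funext j
  refine Fin.cases ?_ (fun j => ?_) j <;> simp [Fin.removeNth, vecCons]

theorem Fin.removeNth_zero_vecCons {T : Type*} {k : ℕ} (x : T) (u : Fin k → T) :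
    (0 : Fin (k + 1)).removeNth (vecCons x u) = u := by
  funext j
  simp [Fin.removeNth]

variable {T N : Type*} [AddCommGroup T] [Module ℝ T] [AddCommGroup N] [Module ℝ N]

namespace AlternatingMap

theorem finsetSum_apply {ι κ : Type*} (s : Finset ι) (g : ι → T [⋀^κ]→ₗ[ℝ] N) (u : κ → T) :
    (∑ i ∈ s, g i) u = ∑ i ∈ s, g i u := by
  classical
  induction s using Finset.induction_on with
  | empty => simp
  | insert a s ha ih => rw [Finset.sum_insert ha, Finset.sum_insert ha, add_apply, ih]

theorem map_vecCons_removeNth {k : ℕ} (f : T [⋀^Fin (k + 1)]→ₗ[ℝ] N) (i : Fin (k + 1))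
    (u : Fin (k + 1) → T) : f (vecCons (u i) (i.removeNth u)) = (-1 : ℝ) ^ (i : ℕ) • f u := by
  rw [← neg_one_pow_smul_map_insertNth f i, Fin.insertNth_self_removeNth,
    ← Int.cast_smul_eq_zsmul ℝ]
  simp

theorem map_vecCons_swap {k : ℕ} (f : T [⋀^Fin (k + 2)]→ₗ[ℝ] N) (x y : T) (u : Fin k → T) :
    f (vecCons x (vecCons y u)) = -f (vecCons y (vecCons x u)) := by
  rw [← f.map_swap (vecCons y (vecCons x u)) (i := 0) (j := 1) (by simp)]
  congr 1
  funext i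
  refine Fin.cases ?_ (fun i => Fin.cases ?_ (fun i => ?_) i) i
  · simp
  · change y = vecCons y (vecCons x u) (Equiv.swap 0 1 (1 : Fin (k + 2)))
    simp
  · rw [Function.comp_apply, Equiv.swap_apply_of_ne_of_ne]
    · rfl
    · exact Fin.succ_ne_zero _
    · exact fun h => Fin.succ_ne_zero i (Fin.succ_injective _ h)

theorem map_vecCons_sum {k : ℕ} {ι : Type*} (f : T [⋀^Fin (k + 1)]→ₗ[ℝ] N) (s : Finset ι)
    (a : ι → ℝ) (v : ι → T) (u : Fin k → T) :
    f (vecCons (∑ i ∈ s, a i • v i) u) = ∑ i ∈ s, a i • f (vecCons (v i) u) := by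
  rw [← curryLeft_apply_apply, map_sum, finsetSum_apply]
  simp

theorem map_vecCons_vecCons_sum {k : ℕ} {ι : Type*} (f : T [⋀^Fin (k + 2)]→ₗ[ℝ] N)
    (s : Finset ι) (a : ι → ℝ) (v : ι → T) (x : T) (u : Fin k → T) :
    f (vecCons x (vecCons (∑ i ∈ s, a i • v i) u)) =
      ∑ i ∈ s, a i • f (vecCons x (vecCons (v i) u)) :=
  map_vecCons_sum (f.curryLeft x) s a v u

/-- The exterior product of a one-form and a form. -/
def oneFormWedge {k : ℕ} (φ : Dual ℝ T) (f : T [⋀^Fin k]→ₗ[ℝ] N) : T [⋀^Fin (k + 1)]→ₗ[ℝ] N :=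
  alternatizeUncurryFin (φ.smulRight f)

theorem oneFormWedge_vecCons {k : ℕ} (φ : Dual ℝ T) (f : T [⋀^Fin (k + 1)]→ₗ[ℝ] N) (x : T)
    (u : Fin (k + 1) → T) : oneFormWedge φ f (vecCons x u) =
      φ x • f u - ∑ i : Fin (k + 1), (-1 : ℝ) ^ (i : ℕ) • φ (u i) • f (vecCons x (i.removeNth u)) := by
  rw [oneFormWedge, alternatizeUncurryFin_apply, Fin.sum_univ_succ, sub_eq_add_neg,
    ← Finset.sum_neg_distrib]
  congr 1
  · simp
  · refine Finset.sum_congr rfl fun i _ => ?_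
    simp only [Fin.removeNth_succ_vecCons, ← Int.cast_smul_eq_zsmul ℝ, Fin.val_succ, pow_succ]
    simp

/-- An Euler identity: contracting d^j ∧ f with d_j and summing gives m copies of f from the terms
d^j(d_j) f, minus one copy for each argument of f. It recovers a form from forms of one degree
higher. -/
theorem sum_oneFormWedge_coord {m k : ℕ} (d : Basis (Fin m) ℝ T) (f : T [⋀^Fin (k + 1)]→ₗ[ℝ] N)
    (u : Fin (k + 1) → T) :
    ∑ j, oneFormWedge (d.coord j) f (vecCons (d j) u) = ((m : ℝ) - (k + 1)) • f u := by
  simp only [oneFormWedge_vecCons, Finset.sum_sub_distrib]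
  rw [Finset.sum_comm, sub_smul]
  congr 1
  · simp [← Nat.cast_smul_eq_nsmul ℝ]
  · have : ∀ i : Fin (k + 1), ∑ j, (-1 : ℝ) ^ (i : ℕ) • d.coord j (u i) •
        f (vecCons (d j) (i.removeNth u)) = f u := fun i => by
      have h : ∑ j, d.coord j (u i) • f.curryLeft (d j) = f.curryLeft (u i) := by
        conv_rhs => rw [← d.sum_repr (u i), map_sum]
        simp only [map_smul]
        rfl
      have h' := DFunLike.congr_fun h (i.removeNth u)
      simp only [finsetSum_apply, smul_apply, curryLeft_apply_apply,
        map_vecCons_removeNth] at h'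
      rw [← Finset.smul_sum, h', smul_smul, ← mul_pow]
      simp
    rw [Finset.sum_congr rfl fun i _ => this i]
    simp [← Nat.cast_smul_eq_nsmul ℝ, add_smul]

theorem eq_zero_of_lt {m k : ℕ} (d : Basis (Fin m) ℝ T) (f : T [⋀^Fin k]→ₗ[ℝ] N) (h : m < k) :
    f = 0 := by
  have := Module.Finite.of_basis d
  ext u
  refine f.map_linearDependent u fun hu => ?_
  have := hu.fintype_card_le_finrank
  rw [finrank_eq_card_basis d] at this
  simp at this
  omega

/-- Cramer's rule for `m + 1` vectors in dimension `m`. -/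
theorem sum_removeNth_of_top {m : ℕ} (d : Basis (Fin (m + 1)) ℝ T) (Ω : T [⋀^Fin (m + 1)]→ₗ[ℝ] ℝ)
    (φ : Dual ℝ T) (x : T) (u : Fin (m + 1) → T) :
    ∑ i : Fin (m + 1), (-1 : ℝ) ^ (i : ℕ) * (φ (u i) * Ω (vecCons x (i.removeNth u))) = φ x * Ω u := by
  have h := oneFormWedge_vecCons φ Ω x u
  rw [eq_zero_of_lt d (oneFormWedge φ Ω) (Nat.lt_succ_self _), zero_apply, eq_comm,
    sub_eq_zero] at h
  simpa using h.symm

/-- Cramer's rule for the family y, u with the term of y split off. In this shape it evaluates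
products with a form of codimension two. -/
theorem sum_removeNth_of_top₂ {m : ℕ} (d : Basis (Fin (m + 2)) ℝ T)
    (Ω : T [⋀^Fin (m + 2)]→ₗ[ℝ] ℝ) (φ : Dual ℝ T) (x y : T) (u : Fin (m + 1) → T) :
    ∑ i : Fin (m + 1), (-1 : ℝ) ^ (i : ℕ) * (φ (u i) * Ω (vecCons x (vecCons y (i.removeNth u)))) =
      φ y * Ω (vecCons x u) - φ x * Ω (vecCons y u) := by
  have h := sum_removeNth_of_top d Ω φ x (vecCons y u)
  rw [Fin.sum_univ_succ] at h
  simp only [Fin.removeNth_succ_vecCons, Fin.removeNth_zero_vecCons, Fin.val_succ, pow_succ] at h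
  simp only [Fin.val_zero, pow_zero, one_mul, Matrix.cons_val_zero, Matrix.cons_val_succ,
    mul_neg, mul_one, neg_mul, Finset.sum_neg_distrib] at h
  linarith

theorem eq_smul_of_top {m : ℕ} (d : Basis (Fin m) ℝ T) (Ω : T [⋀^Fin m]→ₗ[ℝ] ℝ) (hΩ : Ω d ≠ 0)
    (f : T [⋀^Fin m]→ₗ[ℝ] N) (u : Fin m → T) : f u = Ω u • (Ω d)⁻¹ • f d := by
  have : f = (LinearMap.toSpanSingleton ℝ N ((Ω d)⁻¹ • f d)).compAlternatingMap Ω := by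
    refine Basis.ext_alternating d fun v hv => ?_
    let σ : Equiv.Perm (Fin m) := Equiv.ofBijective v (Finite.injective_iff_bijective.mp hv)
    change f (d ∘ σ) = Ω (d ∘ σ) • (Ω d)⁻¹ • f d
    rw [map_perm, map_perm, Units.smul_def, Units.smul_def, smul_assoc, smul_smul,
      mul_inv_cancel₀ hΩ, one_smul]
  conv_lhs => rw [this]
  rfl

/-- In codimension one the Euler identity has factor 1, and each d^j ∧ f has top degree, hence is a
multiple of Ω. -/
theorem exists_sum_of_codim_one {m : ℕ} (d : Basis (Fin (m + 2)) ℝ T)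
    (Ω : T [⋀^Fin (m + 2)]→ₗ[ℝ] ℝ) (hΩ : Ω d ≠ 0) (f : T [⋀^Fin (m + 1)]→ₗ[ℝ] N) :
    ∃ c : Fin (m + 2) → N, ∀ u, f u = ∑ i, Ω (vecCons (d i) u) • c i := by
  refine ⟨fun j => (Ω d)⁻¹ • oneFormWedge (d.coord j) f d, fun u => ?_⟩
  have h := sum_oneFormWedge_coord d f u
  have h1 : ((m + 2 : ℕ) : ℝ) - (m + 1) = 1 := by push_cast; ring
  rw [h1, one_smul] at h
  rw [← h]
  exact Finset.sum_congr rfl fun j _ => eq_smul_of_top d Ω hΩ _ _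

/-- The same argument one degree lower: the Euler factor is now 2, and the forms d^j ∧ f have
codimension one. -/
theorem exists_sum_of_codim_two {m : ℕ} (d : Basis (Fin (m + 3)) ℝ T)
    (Ω : T [⋀^Fin (m + 3)]→ₗ[ℝ] ℝ) (hΩ : Ω d ≠ 0) (f : T [⋀^Fin (m + 1)]→ₗ[ℝ] N) :
    ∃ c : Fin (m + 3) → Fin (m + 3) → N,
      ∀ u, f u = ∑ i, ∑ j, Ω (vecCons (d i) (vecCons (d j) u)) • c i j := by
  choose c hc using fun j => exists_sum_of_codim_one d Ω hΩ (oneFormWedge (d.coord j) f)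
  refine ⟨fun i j => (2 : ℝ)⁻¹ • c j i, fun u => ?_⟩
  have h := sum_oneFormWedge_coord d f u
  have h1 : ((m + 3 : ℕ) : ℝ) - (m + 1) = 2 := by push_cast; ring
  rw [h1] at h
  simp only [hc] at h
  have h2 : f u = (2 : ℝ)⁻¹ • (2 : ℝ) • f u := by rw [smul_smul]; norm_num
  rw [h2, ← h, Finset.sum_comm]
  simp only [Finset.smul_sum]
  exact Finset.sum_congr rfl fun i _ => Finset.sum_congr rfl fun j _ => smul_comm _ _ _

/-- Evaluating on the basis with d_i omitted leaves only the term of i. -/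
theorem eq_zero_of_sum_top {m : ℕ} (d : Basis (Fin (m + 1)) ℝ T)
    (Ω : T [⋀^Fin (m + 1)]→ₗ[ℝ] ℝ) (hΩ : Ω d ≠ 0) (c : Fin (m + 1) → ℝ)
    (h : ∀ u, ∑ i, Ω (vecCons (d i) u) * c i = 0) (i : Fin (m + 1)) : c i = 0 := by
  have h1 := h (i.removeNth d)
  rw [Finset.sum_eq_single_of_mem i (Finset.mem_univ i), map_vecCons_removeNth] at h1
  · simpa [hΩ] using h1
  · intro j _ hj
    obtain ⟨k, rfl⟩ := Fin.exists_succAbove_eq hj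
    rw [Ω.map_eq_zero_of_eq (vecCons (d (i.succAbove k)) (i.removeNth d)) (i := 0) (j := k.succ)
      (by simp [Fin.removeNth]) (Fin.succ_ne_zero k).symm, zero_mul]

/-- Evaluating on the basis with d_i and d_j omitted leaves only the terms (i, j) and (j, i), which
carry opposite signs. -/
theorem symm_of_sum_top {m : ℕ} (d : Basis (Fin (m + 2)) ℝ T)
    (Ω : T [⋀^Fin (m + 2)]→ₗ[ℝ] ℝ) (hΩ : Ω d ≠ 0) (c : Fin (m + 2) → Fin (m + 2) → ℝ)
    (h : ∀ u, ∑ i, ∑ j, Ω (vecCons (d i) (vecCons (d j) u)) * c i j = 0) (i j : Fin (m + 2)) :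
    c i j = c j i := by
  rcases eq_or_ne j i with rfl | hji
  · rfl
  obtain ⟨k, rfl⟩ := Fin.exists_succAbove_eq hji
  have h1 := h (k.removeNth (i.removeNth d))
  have hne : Ω (vecCons (d i) (vecCons (d (i.succAbove k)) (k.removeNth (i.removeNth d)))) ≠ 0 := by
    have e1 := (Ω.curryLeft (d i)).map_vecCons_removeNth k (i.removeNth d)
    rw [curryLeft_apply_apply, curryLeft_apply_apply, map_vecCons_removeNth] at e1
    change Ω (vecCons (d i) (vecCons (i.removeNth (⇑d) k) _)) ≠ 0
    rw [e1]
    simp [hΩ]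
  have hz : ∀ a b : Fin (m + 2), (∃ l : Fin m, a = i.succAbove (k.succAbove l)) →
      Ω (vecCons (d a) (vecCons (d b) (k.removeNth (i.removeNth d)))) = 0 := by
    rintro a b ⟨l, rfl⟩
    exact Ω.map_eq_zero_of_eq _ (i := 0) (j := l.succ.succ) (by simp [Fin.removeNth])
      (Fin.succ_ne_zero _).symm
  have hcase : ∀ a : Fin (m + 2), a = i ∨ a = i.succAbove k ∨
      ∃ l : Fin m, a = i.succAbove (k.succAbove l) := fun a => by
    rcases eq_or_ne a i with rfl | ha
    · exact Or.inl rfl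
    obtain ⟨b, rfl⟩ := Fin.exists_succAbove_eq ha
    rcases eq_or_ne b k with rfl | hb
    · exact Or.inr (Or.inl rfl)
    obtain ⟨l, rfl⟩ := Fin.exists_succAbove_eq hb
    exact Or.inr (Or.inr ⟨l, rfl⟩)
  have hself : ∀ x u, Ω (vecCons x (vecCons x u)) = 0 := fun x u =>
    Ω.map_eq_zero_of_eq _ (i := 0) (j := 1) (by simp) (by simp)
  rw [Fintype.sum_eq_add i (i.succAbove k) hji.symm,
    Finset.sum_eq_single_of_mem (i.succAbove k) (Finset.mem_univ _),
    Finset.sum_eq_single_of_mem i (Finset.mem_univ _), map_vecCons_swap Ω (d (i.succAbove k)) (d i)] at h1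
  · have : Ω (vecCons (d i) (vecCons (d (i.succAbove k)) (k.removeNth (i.removeNth d)))) *
      (c i (i.succAbove k) - c (i.succAbove k) i) = 0 := by linarith
    exact sub_eq_zero.mp ((mul_eq_zero.mp this).resolve_left hne)
  · intro b _ hb
    rcases hcase b with rfl | rfl | hl
    · exact absurd rfl hb
    · rw [hself, zero_mul]
    · rw [map_vecCons_swap, hz b _ hl, neg_zero, zero_mul]
  · intro b _ hb
    rcases hcase b with rfl | rfl | hl
    · rw [hself, zero_mul]
    · exact absurd rfl hb
    · rw [map_vecCons_swap, hz b _ hl, neg_zero, zero_mul]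
  · rintro a ⟨ha, ha'⟩
    refine Finset.sum_eq_zero fun b _ => ?_
    rw [hz a b (((hcase a).resolve_left ha).resolve_left ha'), zero_mul]

end AlternatingMap

end TopForms


/-! ### Forms of bidegree (N-3, N-1) as contracted volume forms, and the two equations. -/

noncomputable section Star

open Matrix (vecCons)
open AlternatingMap

variable {T V : Type*} [AddCommGroup T] [Module ℝ T] [AddCommGroup V] [Module ℝ V]

/-- The sign (-1)^j of graded commutativity cancels the (-1)^j of the internal cyclic shuffles, so
only (-1)^i survives. -/
theorem wedge_oneOne_apply {i j : ℕ} (a : BiForm T V i j) (b : BiForm T V 1 1)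
    (u : Fin (i + 1) → T) (ξ : Fin (j + 1) → Dual ℝ V) :
    wedge a b u ξ = (-1 : ℝ) ^ i * ∑ k : Fin (i + 1), (-1 : ℝ) ^ (k : ℕ) *
      ∑ l : Fin (j + 1), (-1 : ℝ) ^ (l : ℕ) *
        (a (k.removeNth u) (l.removeNth ξ) * b (fun _ => u k) (fun _ => ξ l)) := by
  have h1 : wedge a b u = (-1 : ℝ) ^ (j * 1) • internalWedge j 1
      ((a.domCoprod b).domDomCongr finSumFinEquiv u) := rfl
  have h2 : ∀ (x : Dual ℝ V [⋀^Fin j]→ₗ[ℝ] ℝ) (y : Dual ℝ V [⋀^Fin 1]→ₗ[ℝ] ℝ),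
      internalWedge j 1 (TensorProduct.tmul ℝ x y) ξ = LinearMap.mul' ℝ ℝ
        ((x.domCoprod y).domDomCongr finSumFinEquiv ξ) := fun x y => rfl
  have hsq : ((-1 : ℝ) ^ j) * (-1) ^ j = 1 := by rw [← mul_pow]; simp
  rw [h1, domCoprod_oneForm_apply, map_sum, AlternatingMap.smul_apply, finsetSum_apply]
  simp only [map_smul, AlternatingMap.smul_apply, h2, domCoprod_oneForm_apply, map_sum,
    LinearMap.mul'_apply, smul_eq_mul, mul_one, pow_add, Finset.mul_sum]
  refine Finset.sum_congr rfl fun k _ => Finset.sum_congr rfl fun l _ => ?_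
  linear_combination ((-1) ^ i * ((-1) ^ (k : ℕ) * ((-1) ^ (l : ℕ) *
    (a (k.removeNth u) (l.removeNth ξ) * b (fun _ => u k) (fun _ => ξ l))))) * hsq

theorem oneOneForm_apply (e : T →ₗ[ℝ] V) (u : Fin 1 → T) (ξ : Fin 1 → Dual ℝ V) :
    oneOneForm e u ξ = ξ 0 (e (u 0)) := rfl

theorem coframePow_one_apply (e : T →ₗ[ℝ] V) (u : Fin 1 → T) (ξ : Fin 1 → Dual ℝ V) :
    coframePow e 1 u ξ = ξ 0 (e (u 0)) := by
  change wedge (coframePow e 0) (oneOneForm e) u ξ = _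
  rw [wedge_oneOne_apply]
  simp [coframePow, oneOneForm_apply]

/-- The form `(ι_y ι_x Ω) ⊗ (ι_θ W)` for a form `Ω` on `T` and a form `W` on `V*`. -/
def starForm {i j : ℕ} (Ω : T [⋀^Fin (i + 2)]→ₗ[ℝ] ℝ) (W : Dual ℝ V [⋀^Fin (j + 1)]→ₗ[ℝ] ℝ)
    (x y : T) (θ : Dual ℝ V) : BiForm T V i j :=
  (LinearMap.toSpanSingleton ℝ _ (W.curryLeft θ)).compAlternatingMap ((Ω.curryLeft x).curryLeft y)

theorem starForm_apply {i j : ℕ} (Ω : T [⋀^Fin (i + 2)]→ₗ[ℝ] ℝ)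
    (W : Dual ℝ V [⋀^Fin (j + 1)]→ₗ[ℝ] ℝ) (x y : T) (θ : Dual ℝ V)
    (u : Fin i → T) (ξ : Fin j → Dual ℝ V) :
    starForm Ω W x y θ u ξ = Ω (vecCons x (vecCons y u)) * W (vecCons θ ξ) := rfl

/-- Cramer's rule is used twice: the internal shuffles collapse to θ(e u_k) W(ξ), and the external
ones then to two contractions of Ω. -/
theorem wedgePowMap_one_starForm {i j : ℕ} (d : Basis (Fin (i + 2)) ℝ T)
    (c : Basis (Fin (j + 1)) ℝ (Dual ℝ V)) (Ω : T [⋀^Fin (i + 2)]→ₗ[ℝ] ℝ)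
    (W : Dual ℝ V [⋀^Fin (j + 1)]→ₗ[ℝ] ℝ) (e : T →ₗ[ℝ] V) (x y : T) (θ : Dual ℝ V)
    (u : Fin (i + 1) → T) (ξ : Fin (j + 1) → Dual ℝ V) :
    wedgePowMap e 1 i j (starForm Ω W x y θ) u ξ = (-1 : ℝ) ^ i *
      (W ξ * (θ (e y) * Ω (vecCons x u) - θ (e x) * Ω (vecCons y u))) := by
  change wedge (starForm Ω W x y θ) (coframePow e 1) u ξ = _
  rw [wedge_oneOne_apply]
  congr 1
  have h := sum_removeNth_of_top₂ d Ω (θ.comp e) x y u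
  simp only [LinearMap.comp_apply] at h
  rw [← h, Finset.mul_sum]
  refine Finset.sum_congr rfl fun k _ => ?_
  have h' := sum_removeNth_of_top c W (Dual.eval ℝ V (e (u k))) θ ξ
  simp only [Dual.eval_apply] at h'
  have h'' : W ξ * ((-1 : ℝ) ^ (k : ℕ) * (θ (e (u k)) * Ω (vecCons x (vecCons y (k.removeNth u))))) =
      (-1 : ℝ) ^ (k : ℕ) * (Ω (vecCons x (vecCons y (k.removeNth u))) * (θ (e (u k)) * W ξ)) := by
    ring
  rw [h'', ← h']
  congr 1
  rw [Finset.mul_sum]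
  refine Finset.sum_congr rfl fun l _ => ?_
  rw [starForm_apply, coframePow_one_apply]
  ring

theorem bracketMap_apply {i j : ℕ} (η : V →ₗ[ℝ] Dual ℝ V) (e : T →ₗ[ℝ] V)
    (X : BiForm T V i (j + 1)) (u : Fin (i + 1) → T) (ξ : Fin j → Dual ℝ V) :
    bracketMap η e i j X u ξ = (-1 : ℝ) ^ (i + j) * ∑ k : Fin (i + 1), (-1 : ℝ) ^ (k : ℕ) *
      X (k.removeNth u) (vecCons (η (e (u k))) ξ) := by
  unfold bracketMap
  simp only [LinearMap.coe_mk, AddHom.coe_mk]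
  rw [AlternatingMap.smul_apply, AlternatingMap.smul_apply, alternatizeUncurryFin_apply,
    finsetSum_apply, smul_eq_mul]
  congr 1
  refine Finset.sum_congr rfl fun k _ => ?_
  rw [← Int.cast_smul_eq_zsmul ℝ, AlternatingMap.smul_apply, smul_eq_mul]
  push_cast
  rfl

/-- Here one external application of Cramer's rule suffices, with the one-form z ↦ W(θ, η(e z), ξ).
-/
theorem bracketMap_starForm {i j : ℕ} (d : Basis (Fin (i + 2)) ℝ T)
    (Ω : T [⋀^Fin (i + 2)]→ₗ[ℝ] ℝ) (W : Dual ℝ V [⋀^Fin (j + 2)]→ₗ[ℝ] ℝ) (η : V →ₗ[ℝ] Dual ℝ V)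
    (e : T →ₗ[ℝ] V) (x y : T) (θ : Dual ℝ V) (u : Fin (i + 1) → T) (ξ : Fin j → Dual ℝ V) :
    bracketMap η e i j (starForm Ω W x y θ) u ξ = (-1 : ℝ) ^ (i + j) *
      (W (vecCons θ (vecCons (η (e y)) ξ)) * Ω (vecCons x u) -
        W (vecCons θ (vecCons (η (e x)) ξ)) * Ω (vecCons y u)) := by
  rw [bracketMap_apply]
  congr 1
  let φ : Dual ℝ T :=
    { toFun := fun z => (W.curryLeft θ).curryLeft (η (e z)) ξ
      map_add' := fun z z' => by simp
      map_smul' := fun r z => by simp }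
  have h : ∑ k : Fin (i + 1), (-1 : ℝ) ^ (k : ℕ) *
      (φ (u k) * Ω (vecCons x (vecCons y (k.removeNth u)))) =
      W (vecCons θ (vecCons (η (e y)) ξ)) * Ω (vecCons x u) -
        W (vecCons θ (vecCons (η (e x)) ξ)) * Ω (vecCons y u) :=
    sum_removeNth_of_top₂ d Ω φ x y u
  rw [← h]
  refine Finset.sum_congr rfl fun k _ => ?_
  rw [starForm_apply, mul_comm (Ω _)]
  rfl

theorem exists_sum_starForm {n k : ℕ} (d : Basis (Fin (n + 3)) ℝ T)
    (c : Basis (Fin (k + 2)) ℝ (Dual ℝ V)) (Ω : T [⋀^Fin (n + 3)]→ₗ[ℝ] ℝ) (hΩ : Ω d ≠ 0)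
    (W : Dual ℝ V [⋀^Fin (k + 2)]→ₗ[ℝ] ℝ) (hW : W c ≠ 0) (τ : BiForm T V (n + 1) (k + 1)) :
    ∃ P : Fin (n + 3) → Fin (n + 3) → Dual ℝ V, (∀ i j, P i j = -P j i) ∧
      τ = ∑ i, ∑ j, starForm Ω W (d i) (d j) (P i j) := by
  obtain ⟨m, hm⟩ := exists_sum_of_codim_two d Ω hΩ τ
  choose r hr using fun i j => exists_sum_of_codim_one c W hW (m i j)
  let Q : Fin (n + 3) → Fin (n + 3) → Dual ℝ V := fun i j => ∑ a, r i j a • c a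
  have hQ : ∀ i j, m i j = W.curryLeft (Q i j) := fun i j => by
    ext ξ
    rw [hr, map_sum, finsetSum_apply]
    refine Finset.sum_congr rfl fun a _ => ?_
    rw [map_smul, AlternatingMap.smul_apply, curryLeft_apply_apply, smul_eq_mul, smul_eq_mul,
      mul_comm]
  -- Only the antisymmetric part of the coefficients is seen by Ω; antisymmetrising makes them
  -- unique, which the later index argument relies on.
  refine ⟨fun i j => (2 : ℝ)⁻¹ • (Q i j - Q j i), fun i j => ?_, ?_⟩
  · module
  ext u ξ
  have e1 : τ u ξ = ∑ i, ∑ j, Ω (vecCons (d i) (vecCons (d j) u)) * W (vecCons (Q i j) ξ) := by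
    rw [hm, finsetSum_apply]
    refine Finset.sum_congr rfl fun i _ => ?_
    rw [finsetSum_apply]
    refine Finset.sum_congr rfl fun j _ => ?_
    rw [hQ]
    rfl
  have e2 : τ u ξ = -∑ i, ∑ j, Ω (vecCons (d i) (vecCons (d j) u)) * W (vecCons (Q j i) ξ) := by
    rw [e1, Finset.sum_comm, ← Finset.sum_neg_distrib]
    refine Finset.sum_congr rfl fun i _ => ?_
    rw [← Finset.sum_neg_distrib]
    refine Finset.sum_congr rfl fun j _ => ?_
    rw [map_vecCons_swap, neg_mul]
  have e3 : τ u ξ = (2 : ℝ)⁻¹ * (τ u ξ + τ u ξ) := by ring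
  rw [e3]
  conv_lhs => rw [e1]
  conv_lhs => enter [2, 2]; rw [← e1, e2]
  rw [← sub_eq_add_neg, ← Finset.sum_sub_distrib, Finset.mul_sum, finsetSum_apply,
    finsetSum_apply]
  refine Finset.sum_congr rfl fun i _ => ?_
  rw [← Finset.sum_sub_distrib, Finset.mul_sum, finsetSum_apply, finsetSum_apply]
  refine Finset.sum_congr rfl fun j _ => ?_
  have h : W (vecCons ((2 : ℝ)⁻¹ • (Q i j - Q j i)) ξ) =
      (2 : ℝ)⁻¹ * (W (vecCons (Q i j) ξ) - W (vecCons (Q j i) ξ)) := by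
    simp only [← curryLeft_apply_apply, map_smul, map_sub, AlternatingMap.smul_apply,
      AlternatingMap.sub_apply, smul_eq_mul]
  rw [starForm_apply, h]
  ring

/-- The core of Cartan's lemma: contraction with a volume form loses no information about a
bivector, so ∑ α_j ∧ β_j = 0 and the tensor ∑ α_j ⊗ β_j is symmetric. -/
theorem symm_of_sum_wedge {k : ℕ} {ι : Type*} [Fintype ι] (c : Basis (Fin (k + 2)) ℝ (Dual ℝ V))
    (W : Dual ℝ V [⋀^Fin (k + 2)]→ₗ[ℝ] ℝ) (hW : W c ≠ 0) (α β : ι → Dual ℝ V)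
    (h : ∀ ξ, ∑ j, W (vecCons (α j) (vecCons (β j) ξ)) = 0) (v w : V) :
    ∑ j, α j v * β j w = ∑ j, α j w * β j v := by
  have hs := symm_of_sum_top c W hW (fun a b => ∑ j, c.repr (α j) a * c.repr (β j) b) fun ξ => by
    rw [← h ξ]
    have : ∀ j, W (vecCons (α j) (vecCons (β j) ξ)) = ∑ a, ∑ b,
        W (vecCons (c a) (vecCons (c b) ξ)) * (c.repr (α j) a * c.repr (β j) b) := fun j => by
      have e1 : W (vecCons (α j) (vecCons (β j) ξ)) = W (vecCons (∑ a, c.repr (α j) a • c a)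
          (vecCons (∑ b, c.repr (β j) b • c b) ξ)) := by
        rw [c.sum_repr, c.sum_repr]
      rw [e1, map_vecCons_sum]
      refine Finset.sum_congr rfl fun a _ => ?_
      rw [map_vecCons_vecCons_sum, Finset.smul_sum]
      refine Finset.sum_congr rfl fun b _ => ?_
      rw [smul_eq_mul, smul_eq_mul]
      ring
    simp only [this, Finset.mul_sum]
    rw [eq_comm, Finset.sum_comm]
    refine Finset.sum_congr rfl fun a _ => ?_
    rw [Finset.sum_comm]
  have hx : ∀ v w, ∑ j, α j v * β j w = ∑ a, ∑ b,
      (∑ j, c.repr (α j) a * c.repr (β j) b) * (c a v * c b w) := fun v w => by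
    have e1 : ∀ j, α j v = ∑ a, c.repr (α j) a * c a v := fun j => by
      conv_lhs => rw [← c.sum_repr (α j)]
      simp [-Basis.sum_repr]
    have e2 : ∀ j, β j w = ∑ a, c.repr (β j) a * c a w := fun j => by
      conv_lhs => rw [← c.sum_repr (β j)]
      simp [-Basis.sum_repr]
    simp only [e1, e2, Finset.sum_mul_sum]
    simp only [Finset.sum_mul]
    rw [Finset.sum_comm]
    refine Finset.sum_congr rfl fun a _ => ?_
    rw [Finset.sum_comm]
    refine Finset.sum_congr rfl fun b _ => Finset.sum_congr rfl fun j _ => by ring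
  rw [hx, hx, Finset.sum_comm]
  refine Finset.sum_congr rfl fun a _ => Finset.sum_congr rfl fun b _ => ?_
  rw [hs b a]
  ring

end Star


/-! ### Solutions of the two equations as symmetric matrices. -/

noncomputable section DegeneracyFibre

open Matrix (vecCons)
open AlternatingMap

variable {T V : Type*} [AddCommGroup T] [Module ℝ T] [AddCommGroup V] [Module ℝ V]

/-- `∑ B_jν (ι_{Y_j} ι_x Ω) ⊗ (ι_{θ_ν} W)`. -/
def starSum {n k : ℕ} (Ω : T [⋀^Fin (n + 3)]→ₗ[ℝ] ℝ) (W : Dual ℝ V [⋀^Fin (k + 2)]→ₗ[ℝ] ℝ)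
    (x : T) (Y : Fin (n + 2) → T) (θ : Fin (n + 2) → Dual ℝ V)
    (B : Matrix (Fin (n + 2)) (Fin (n + 2)) ℝ) : BiForm T V (n + 1) (k + 1) :=
  ∑ j, ∑ ν, B j ν • starForm Ω W x (Y j) (θ ν)

theorem starSum_apply {n k : ℕ} (Ω : T [⋀^Fin (n + 3)]→ₗ[ℝ] ℝ)
    (W : Dual ℝ V [⋀^Fin (k + 2)]→ₗ[ℝ] ℝ)
    (x : T) (Y : Fin (n + 2) → T) (θ : Fin (n + 2) → Dual ℝ V)
    (B : Matrix (Fin (n + 2)) (Fin (n + 2)) ℝ) (u : Fin (n + 1) → T)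
    (ξ : Fin (k + 1) → Dual ℝ V) :
    starSum Ω W x Y θ B u ξ =
      ∑ j, ∑ ν, B j ν * (Ω (vecCons x (vecCons (Y j) u)) * W (vecCons (θ ν) ξ)) := by
  simp only [starSum, finsetSum_apply]
  rfl

/-- The wedge equation produces the factor `htr`. The bracket pairs the symmetric `B` with the
antisymmetric W(θ_ν, θ_j, ·) and therefore vanishes. -/
theorem starSum_mem_degeneracyFibre {n : ℕ} (d : Basis (Fin (n + 3)) ℝ T)
    (c : Basis (Fin (n + 4)) ℝ (Dual ℝ V)) (Ω : T [⋀^Fin (n + 3)]→ₗ[ℝ] ℝ)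
    (W : Dual ℝ V [⋀^Fin (n + 4)]→ₗ[ℝ] ℝ) (η : V →ₗ[ℝ] Dual ℝ V) (e e' : T →ₗ[ℝ] V)
    (x : T) (Y : Fin (n + 2) → T) (hx : e' x = 0)
    (hθx : ∀ ν, η (e' (Y ν)) (e x) = 0)
    (B : Matrix (Fin (n + 2)) (Fin (n + 2)) ℝ) (hB : B.IsSymm)
    (htr : ∑ j, ∑ ν, B j ν * η (e' (Y ν)) (e (Y j)) = 0) :
    starSum Ω W x Y (fun ν => η (e' (Y ν))) B ∈ degeneracyFibre n η e e' := by
  refine ⟨?_, ?_⟩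
  · rw [SetLike.mem_coe, LinearMap.mem_ker]
    ext u ξ
    simp only [starSum, map_sum, map_smul, finsetSum_apply, AlternatingMap.smul_apply]
    have h : ∀ j ν, B j ν • wedgePowMap e 1 (n + 1) (n + 3)
        (starForm Ω W x (Y j) (η (e' (Y ν)))) u ξ =
        (-1) ^ (n + 1) * (W ξ * Ω (vecCons x u)) * (B j ν * η (e' (Y ν)) (e (Y j))) :=
      fun j ν => by
        have h' := wedgePowMap_one_starForm d c Ω W e x (Y j) (η (e' (Y ν))) u ξ
        rw [hθx] at h'
        rw [h', smul_eq_mul]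
        ring
    simp only [h, ← Finset.mul_sum, htr, mul_zero]
    rfl
  · rw [SetLike.mem_coe, LinearMap.mem_ker]
    ext u ξ
    simp only [starSum, map_sum, map_smul, finsetSum_apply, AlternatingMap.smul_apply]
    let w : Fin (n + 2) → Fin (n + 2) → ℝ := fun ν j =>
      W (vecCons (η (e' (Y ν))) (vecCons (η (e' (Y j))) ξ))
    have hw : ∀ ν j, w ν j = -w j ν := fun ν j => map_vecCons_swap W _ _ ξ
    have h0 : ∀ θ, W (vecCons θ (vecCons 0 ξ)) = 0 := fun θ => by
      refine W.map_coord_zero (i := 1) ?_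
      simp
    have h : ∀ j ν, B j ν • bracketMap η e' (n + 1) (n + 2)
        (starForm Ω W x (Y j) (η (e' (Y ν)))) u ξ =
        (-1) ^ (n + 1 + (n + 2)) * Ω (vecCons x u) * (B j ν * w ν j) :=
      fun j ν => by
        have h' := bracketMap_starForm d Ω W η e' x (Y j) (η (e' (Y ν))) u ξ
        rw [hx, _root_.map_zero, h0] at h'
        rw [h', smul_eq_mul]
        simp only [w]
        ring
    simp only [h, ← Finset.mul_sum]
    have hs : ∑ j, ∑ ν, B j ν * w ν j = -∑ j, ∑ ν, B j ν * w ν j := by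
      conv_lhs => rw [Finset.sum_comm]
      rw [← Finset.sum_neg_distrib]
      refine Finset.sum_congr rfl fun j _ => ?_
      rw [← Finset.sum_neg_distrib]
      refine Finset.sum_congr rfl fun ν _ => ?_
      rw [hB.apply, hw, mul_neg]
    rw [show ∑ j, ∑ ν, B j ν * w ν j = 0 by linarith, mul_zero]
    rfl

/-- The converse: Cartan's lemma for each first index of `P`, followed by the clash between symmetry
in the last two indices and antisymmetry in the first two. -/
theorem exists_starSum_of_mem_degeneracyFibre {n : ℕ} (d : Basis (Fin (n + 3)) ℝ T)
    (c : Basis (Fin (n + 4)) ℝ (Dual ℝ V)) (Ω : T [⋀^Fin (n + 3)]→ₗ[ℝ] ℝ) (hΩ : Ω d ≠ 0)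
    (W : Dual ℝ V [⋀^Fin (n + 4)]→ₗ[ℝ] ℝ) (hW : W c ≠ 0) (η : V →ₗ[ℝ] Dual ℝ V)
    (e e' : T →ₗ[ℝ] V) (x : T) (Y : Fin (n + 2) → T) (hd : ⇑d = vecCons x Y) (hx : e' x = 0)
    (hθ : LinearIndependent ℝ fun ν => η (e' (Y ν)))
    {τ : BiForm T V (n + 1) (n + 3)} (hτ : τ ∈ degeneracyFibre n η e e') :
    ∃ B : Matrix (Fin (n + 2)) (Fin (n + 2)) ℝ, B.IsSymm ∧
      ∑ j, ∑ ν, B j ν * η (e' (Y ν)) (e (Y j)) = 0 ∧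
      τ = starSum Ω W x Y (fun ν => η (e' (Y ν))) B := by
  have hd0 : d 0 = x := by rw [hd]; rfl
  have hds : ∀ j, d (Fin.succ j) = Y j := fun j => by rw [hd]; rfl
  obtain ⟨P, hP, rfl⟩ := exists_sum_starForm d c Ω hΩ W hW τ
  -- the two equations in terms of `P`
  have sum_anti : ∀ (q : Fin (n + 3) → Fin (n + 3) → ℝ) (q' : Fin (n + 3) → Fin (n + 3) → ℝ)
      (o : Fin (n + 3) → ℝ), (∀ i j, q' i j = -q j i) →
      ∑ i, ∑ j, (q i j * o i - q' i j * o j) = 2 * ∑ i, o i * ∑ j, q i j := fun q q' o h => by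
    simp only [h, neg_mul, sub_neg_eq_add, Finset.sum_add_distrib]
    rw [Finset.sum_comm (f := fun i j => q j i * o j), two_mul]
    simp only [Finset.mul_sum, mul_comm]
  have hWdg : ∀ i, ∑ j, P i j (e (d j)) = 0 := by
    refine eq_zero_of_sum_top d Ω hΩ _ fun u => ?_
    have h := DFunLike.congr_fun (DFunLike.congr_fun (LinearMap.mem_ker.mp hτ.1) u) (⇑c)
    simp only [map_sum, finsetSum_apply] at h
    have h1 : ∀ i j, wedgePowMap e 1 (n + 1) (n + 3) (starForm Ω W (d i) (d j) (P i j)) u c =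
        (-1) ^ (n + 1) * W c * (P i j (e (d j)) * Ω (vecCons (d i) u) -
          P i j (e (d i)) * Ω (vecCons (d j) u)) := fun i j => by
      rw [mul_assoc]
      exact wedgePowMap_one_starForm d c Ω W e (d i) (d j) (P i j) u c
    simp only [h1, ← Finset.mul_sum] at h
    rw [sum_anti (fun i j => P i j (e (d j))) (fun i j => P i j (e (d i))) _
      fun i j => by rw [hP i j]; rfl] at h
    simpa [hW] using h
  have hBr : ∀ i ξ, ∑ j, W (vecCons (P i j) (vecCons (η (e' (d j))) ξ)) = 0 := fun i ξ => by
    revert i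
    refine eq_zero_of_sum_top d Ω hΩ _ fun u => ?_
    have h := DFunLike.congr_fun (DFunLike.congr_fun (LinearMap.mem_ker.mp hτ.2) u) ξ
    simp only [map_sum, finsetSum_apply] at h
    have h1 : ∀ i j, bracketMap η e' (n + 1) (n + 2) (starForm Ω W (d i) (d j) (P i j)) u ξ =
        (-1) ^ (n + 1 + (n + 2)) *
          (W (vecCons (P i j) (vecCons (η (e' (d j))) ξ)) * Ω (vecCons (d i) u) -
          W (vecCons (P i j) (vecCons (η (e' (d i))) ξ)) * Ω (vecCons (d j) u)) := fun i j =>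
      bracketMap_starForm d Ω W η e' (d i) (d j) (P i j) u ξ
    simp only [h1, ← Finset.mul_sum] at h
    rw [sum_anti (fun i j => W (vecCons (P i j) (vecCons (η (e' (d j))) ξ)))
      (fun i j => W (vecCons (P i j) (vecCons (η (e' (d i))) ξ))) _ fun i j => by
        rw [hP i j, ← curryLeft_apply_apply, map_neg]; rfl] at h
    simpa using h
  -- The index 0 drops out since `e'` kills `x`, so only the independent covectors remain.
  have hsym : ∀ i v w, ∑ j : Fin (n + 2), P i j.succ v * η (e' (Y j)) w =
      ∑ j : Fin (n + 2), P i j.succ w * η (e' (Y j)) v := fun i v w => by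
    have h := symm_of_sum_wedge c W hW (P i) (fun j => η (e' (d j))) (hBr i) v w
    simpa [Fin.sum_univ_succ, hd0, hds, hx] using h
  -- `P i j` is a combination of the `θ ν`
  have hspan : ∀ i (j : Fin (n + 2)), ∃ b : Fin (n + 2) → ℝ,
      P i j.succ = ∑ ν, b ν • η (e' (Y ν)) := fun i j => by
    have : P i j.succ ∈ Submodule.span ℝ (Set.range fun ν => η (e' (Y ν))) := by
      -- For v in the common kernel of the covectors θ_j, the symmetric identity leaves ∑_j P_ij(v)
      -- θ_j = 0, and independence gives P_ij(v) = 0.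
      refine mem_span_of_iInf_ker_le_ker fun v hv => ?_
      rw [Submodule.mem_iInf] at hv
      have h0 : ∑ j : Fin (n + 2), P i j.succ v • η (e' (Y j)) = 0 := by
        ext w
        have := hsym i v w
        simp only [LinearMap.mem_ker.mp (hv _), mul_zero, Finset.sum_const_zero] at this
        simpa using this
      exact Fintype.linearIndependent_iff.mp hθ _ h0 j
    obtain ⟨b, hb⟩ := (Submodule.mem_span_range_iff_exists_fun ℝ).mp this
    exact ⟨b, hb.symm⟩
  choose b hb using hspan
  have hbsym : ∀ i j ν, b i j ν = b i ν j := fun i j ν => by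
    have h0 : ∀ w ν, ∑ j, (b i j ν - b i ν j) * η (e' (Y j)) w = 0 := fun w => by
      refine Fintype.linearIndependent_iff.mp hθ _ ?_
      ext v
      have h := hsym i v w
      simp only [hb, LinearMap.sum_apply, LinearMap.smul_apply, smul_eq_mul,
        Finset.sum_mul] at h ⊢
      simp only [sub_mul, Finset.sum_sub_distrib, LinearMap.zero_apply]
      rw [sub_eq_zero, Finset.sum_comm]
      refine Eq.trans ?_ (h.trans ?_)
      · exact Finset.sum_congr rfl fun _ _ => Finset.sum_congr rfl fun _ _ => by ring
      · exact Finset.sum_congr rfl fun _ _ => Finset.sum_congr rfl fun _ _ => by ring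
    have h1 : ∑ j, (b i j ν - b i ν j) • η (e' (Y j)) = 0 := by
      ext w
      simpa using h0 w ν
    exact sub_eq_zero.mp (Fintype.linearIndependent_iff.mp hθ _ h1 j)
  have hbanti : ∀ i j ν : Fin (n + 2), b i.succ j ν = -b j.succ i ν := fun i j ν => by
    have h1 : ∑ ν, (b i.succ j ν + b j.succ i ν) • η (e' (Y ν)) = 0 := by
      simp only [add_smul, Finset.sum_add_distrib, ← hb]
      rw [hP]
      simp
    exact eq_neg_of_add_eq_zero_left (Fintype.linearIndependent_iff.mp hθ _ h1 ν)
  -- Six alternating uses of antisymmetry in the first pair and symmetry in the last pair give b =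
  -- -b, as in the uniqueness of the Levi-Civita connection.
  have hPss : ∀ i j : Fin (n + 2), P i.succ j.succ = 0 := fun i j => by
    rw [hb]
    refine Finset.sum_eq_zero fun ν _ => ?_
    have h1 := hbanti i j ν
    have h2 := hbsym j.succ i ν
    have h3 := hbanti j ν i
    have h4 := hbsym ν.succ j i
    have h5 := hbanti ν i j
    have h6 := hbsym i.succ ν j
    rw [show b i.succ j ν = 0 by linarith, zero_smul]
  have hP00 : P 0 0 = 0 := by
    ext v
    have := DFunLike.congr_fun (hP 0 0) v
    rw [LinearMap.neg_apply] at this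
    rw [LinearMap.zero_apply]
    linarith
  -- The terms (0, j) and (j, 0) of the double sum contribute equally, whence the 2.
  refine ⟨Matrix.of fun j ν => 2 * b 0 j ν, ?_, ?_, ?_⟩
  · ext j ν
    simp [hbsym 0 j ν]
  · have h := hWdg 0
    rw [Fin.sum_univ_succ, hP00, LinearMap.zero_apply, zero_add] at h
    simp only [hb, hds, LinearMap.sum_apply, LinearMap.smul_apply, smul_eq_mul] at h
    simp only [Matrix.of_apply, mul_assoc, ← Finset.mul_sum, h, mul_zero]
  · ext u ξ
    rw [starSum_apply]
    simp only [finsetSum_apply, starForm_apply]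
    have hW0 : W (vecCons 0 ξ) = 0 := W.map_coord_zero (i := 0) (by simp)
    have hneg : ∀ θ, W (vecCons (-θ) ξ) = -W (vecCons θ ξ) := fun θ => by
      rw [← curryLeft_apply_apply, map_neg]; rfl
    rw [Fin.sum_univ_succ, Fin.sum_univ_succ]
    simp only [Fin.sum_univ_succ (n := n + 2), hP00, hPss, hW0, mul_zero, zero_add,
      Finset.sum_const_zero, add_zero, hd0, hds]
    have h1 : ∀ j : Fin (n + 2), Ω (vecCons (Y j) (vecCons x u)) * W (vecCons (P j.succ 0) ξ) =
        Ω (vecCons x (vecCons (Y j) u)) * W (vecCons (P 0 j.succ) ξ) := fun j => by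
      rw [map_vecCons_swap, hP, hneg]
      ring
    simp only [h1, hb, map_vecCons_sum, ← Finset.sum_add_distrib]
    refine Finset.sum_congr rfl fun j _ => ?_
    rw [Finset.mul_sum, ← Finset.sum_add_distrib]
    refine Finset.sum_congr rfl fun ν _ => ?_
    rw [smul_eq_mul, Matrix.of_apply]
    ring

end DegeneracyFibre


/-! ### Null vectors of a Lorentzian form. -/

section Lorentzian

variable {T V : Type*} [AddCommGroup T] [Module ℝ T] [AddCommGroup V] [Module ℝ V]

/-- A bilinear form with an orthonormal basis of signature `(m, 1)`. -/
def IsLorentzian (m : ℕ) (η : V →ₗ[ℝ] Dual ℝ V) : Prop :=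
  ∃ b : Basis (Fin (m + 1)) ℝ V, ∀ i j,
    η (b i) (b j) = if i = j then (if i = Fin.last m then -1 else 1) else 0

theorem bilin_apply_of_orthonormal {m : ℕ} {η : V →ₗ[ℝ] Dual ℝ V} {b : Basis (Fin (m + 1)) ℝ V}
    (hb : ∀ i j, η (b i) (b j) = if i = j then (if i = Fin.last m then -1 else 1) else 0)
    (v w : V) : η v w = ∑ i : Fin m, b.repr v i.castSucc * b.repr w i.castSucc -
      b.repr v (Fin.last m) * b.repr w (Fin.last m) := by
  conv_lhs => rw [← b.sum_repr v, ← b.sum_repr w]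
  simp only [map_sum, map_smul, LinearMap.sum_apply, LinearMap.smul_apply, hb, smul_eq_mul]
  rw [Fin.sum_univ_castSucc]
  simp [Fin.castSucc_ne_last, sub_eq_add_neg, mul_comm]

namespace IsLorentzian

variable {m : ℕ} {η : V →ₗ[ℝ] Dual ℝ V}

theorem symm (h : IsLorentzian m η) (v w : V) : η v w = η w v := by
  obtain ⟨b, hb⟩ := h
  rw [bilin_apply_of_orthonormal hb, bilin_apply_of_orthonormal hb]
  simp only [mul_comm]

theorem eq_zero (h : IsLorentzian m η) {v : V} (hv : ∀ w, η v w = 0) : v = 0 := by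
  obtain ⟨b, hb⟩ := h
  refine b.ext_elem fun i => ?_
  have := hv (b i)
  rw [bilin_apply_of_orthonormal hb] at this
  rcases Fin.eq_castSucc_or_eq_last i with ⟨i, rfl⟩ | rfl
  · simpa [Finsupp.single_apply, (Fin.castSucc_ne_last _).symm, Fin.castSucc_ne_last] using this
  · simpa [Finsupp.single_apply, (Fin.castSucc_ne_last _).symm, Fin.castSucc_ne_last] using this

/-- A Lagrange identity: on the orthogonal complement of a null vector with nonzero time component
the form is a sum of squares, and each square measures the failure of w to be proportional to v. -/
theorem sq_mul_apply_self {b : Basis (Fin (m + 1)) ℝ V}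
    (hb : ∀ i j, η (b i) (b j) = if i = j then (if i = Fin.last m then -1 else 1) else 0)
    {v w : V} (hv : η v v = 0) (hvw : η v w = 0) :
    b.repr v (Fin.last m) ^ 2 * η w w = ∑ i : Fin m, (b.repr v (Fin.last m) *
      b.repr w i.castSucc - b.repr w (Fin.last m) * b.repr v i.castSucc) ^ 2 := by
  rw [bilin_apply_of_orthonormal hb] at hv hvw ⊢
  have : ∀ i : Fin m, (b.repr v (Fin.last m) *
      b.repr w i.castSucc - b.repr w (Fin.last m) * b.repr v i.castSucc) ^ 2 =
      b.repr v (Fin.last m) ^ 2 * (b.repr w i.castSucc * b.repr w i.castSucc) -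
      2 * (b.repr v (Fin.last m) * b.repr w (Fin.last m)) *
        (b.repr v i.castSucc * b.repr w i.castSucc) +
      b.repr w (Fin.last m) ^ 2 * (b.repr v i.castSucc * b.repr v i.castSucc) := fun i => by ring
  simp only [this, Finset.sum_add_distrib, Finset.sum_sub_distrib, ← Finset.mul_sum]
  linear_combination (-b.repr w (Fin.last m) ^ 2) * hv +
    2 * (b.repr v (Fin.last m) * b.repr w (Fin.last m)) * hvw

theorem repr_last_ne_zero {b : Basis (Fin (m + 1)) ℝ V}
    (hb : ∀ i j, η (b i) (b j) = if i = j then (if i = Fin.last m then -1 else 1) else 0)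
    {v : V} (hv : η v v = 0) (hv0 : v ≠ 0) : b.repr v (Fin.last m) ≠ 0 := fun h => by
  rw [bilin_apply_of_orthonormal hb, h, mul_zero, sub_zero,
    Finset.sum_eq_zero_iff_of_nonneg fun i _ => mul_self_nonneg _] at hv
  refine hv0 (b.ext_elem fun i => ?_)
  rcases Fin.eq_castSucc_or_eq_last i with ⟨i, rfl⟩ | rfl
  · simpa using hv i (Finset.mem_univ i)
  · simpa using h

theorem exists_smul_of_orthogonal_null (h : IsLorentzian m η) {v w : V} (hv : η v v = 0)
    (hv0 : v ≠ 0) (hvw : η v w = 0) (hw : η w w = 0) : ∃ r : ℝ, w = r • v := by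
  obtain ⟨b, hb⟩ := h
  have h1 := sq_mul_apply_self hb hv hvw
  have h2 := repr_last_ne_zero hb hv hv0
  rw [hw, mul_zero, eq_comm, Finset.sum_eq_zero_iff_of_nonneg fun i _ => sq_nonneg _] at h1
  refine ⟨b.repr w (Fin.last m) / b.repr v (Fin.last m), b.ext_elem fun i => ?_⟩
  rcases Fin.eq_castSucc_or_eq_last i with ⟨i, rfl⟩ | rfl
  · have := h1 i (Finset.mem_univ i)
    rw [sq_eq_zero_iff] at this
    simp only [map_smul, Finsupp.smul_apply, smul_eq_mul]
    field_simp
    linarith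
  · simp only [map_smul, Finsupp.smul_apply, smul_eq_mul]
    field_simp

variable {e : T →ₗ[ℝ] V} {x : T}

theorem exists_smul_of_null (h : IsLorentzian m η) (he : Function.Injective e) (hx0 : x ≠ 0)
    (hx : ∀ u, η (e x) (e u) = 0) {u : T} (hu : η (e u) (e u) = 0) : ∃ r : ℝ, u = r • x := by
  obtain ⟨r, hr⟩ := h.exists_smul_of_orthogonal_null (hx x)
    (fun h0 => hx0 (he (h0.trans (map_zero e).symm))) (hx u) hu
  exact ⟨r, he (by rw [hr, map_smul])⟩

/-- The degenerate metric `η(e, e)` is definite transversally to its kernel. -/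
theorem gram_definite (h : IsLorentzian m η) (he : Function.Injective e) {k : ℕ} {Y : Fin k → T}
    (hY : LinearIndependent ℝ (Matrix.vecCons x Y)) (hx : ∀ u, η (e x) (e u) = 0) (a : Fin k → ℝ)
    (ha : η (e (∑ i, a i • Y i)) (e (∑ i, a i • Y i)) = 0) : a = 0 := by
  have hY' := linearIndependent_finCons.mp hY
  have hx0 : x ≠ 0 := hY.ne_zero 0
  obtain ⟨r, hr⟩ := h.exists_smul_of_null he hx0 hx ha
  rcases eq_or_ne r 0 with rfl | hr0
  · rw [zero_smul] at hr
    exact funext (Fintype.linearIndependent_iff.mp hY'.1 a hr)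
  · refine absurd ?_ hY'.2
    have : x = r⁻¹ • ∑ i, a i • Y i := by rw [hr, smul_smul, inv_mul_cancel₀ hr0, one_smul]
    rw [this]
    exact Submodule.smul_mem _ _ (Submodule.sum_mem _ fun i _ =>
      Submodule.smul_mem _ _ (Submodule.subset_span ⟨i, rfl⟩))

end IsLorentzian

end Lorentzian

/-! ### Self-adjoint matrices are determined by one triangle. -/

section TriangularCompletion

open Matrix

variable {k : ℕ}

/-- A nilpotent self-adjoint operator of a definite form is zero. Columns are treated from the last
backwards: if all later columns vanish, L maps its column a = L e_j to 0, and aᵀ g a = e_jᵀ g L a =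
0. -/
theorem eq_zero_of_strictlyLower_of_symm {g L : Matrix (Fin k) (Fin k) ℝ} (hg : g.IsSymm)
    (hdef : ∀ a : Fin k → ℝ, a ⬝ᵥ g *ᵥ a = 0 → a = 0) (hL : ∀ i j, i ≤ j → L i j = 0)
    (hgL : (g * L).IsSymm) : L = 0 := by
  have hcol : ∀ m : ℕ, ∀ j : Fin k, k - m ≤ (j : ℕ) → L.col j = 0 := by
    intro m
    induction m with
    | zero => intro j hj; omega
    | succ m ih =>
      intro j hj
      have h2 : L *ᵥ L.col j = 0 := by
        have : L *ᵥ L.col j = ∑ i, L i j • L.col i := by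
          ext a
          simp [Matrix.mulVec, dotProduct, Finset.sum_apply, mul_comm]
        rw [this]
        refine Finset.sum_eq_zero fun i _ => ?_
        rcases le_or_gt i j with hij | hij
        · rw [hL i j hij, zero_smul]
        · rw [ih i (by have := Fin.lt_def.mp hij; omega), smul_zero]
      refine hdef _ ?_
      have h3 : Lᵀ * g = g * L := by
        have := hgL.eq
        rwa [transpose_mul, hg.eq] at this
      have h4 : L.col j = L *ᵥ Pi.single j 1 := by simp
      calc L.col j ⬝ᵥ g *ᵥ L.col j = (Pi.single j 1) ⬝ᵥ (Lᵀ * g) *ᵥ L.col j := by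
            rw [← mulVec_mulVec]
            nth_rw 1 [h4]
            rw [Matrix.dotProduct_mulVec (Pi.single j 1) Lᵀ, vecMul_transpose]
        _ = 0 := by rw [h3, ← mulVec_mulVec, h2, mulVec_zero, dotProduct_zero]
  ext i j
  exact congrFun (hcol k j (by omega)) i

/-- For a definite symmetric matrix `g`, a matrix `Z` such that `g Z` is symmetric is
determined by its upper triangular part. -/
theorem exists_triangular_completion (g : Matrix (Fin k) (Fin k) ℝ) :
    ∃ f : Fin k → Fin k →
        (({p : Fin k × Fin k // p.1 < p.2} → ℝ) × (Fin k → ℝ)) →ₗ[ℝ] ℝ,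
      g.IsSymm → (∀ a : Fin k → ℝ, a ⬝ᵥ g *ᵥ a = 0 → a = 0) →
        ∀ Z : Matrix (Fin k) (Fin k) ℝ, (g * Z).IsSymm ↔ ∀ i j, i < j →
          Z j i = f i j (fun p => Z p.1.1 p.1.2, fun i => -Z i i) := by
  by_cases hg : g.IsSymm ∧ ∀ a : Fin k → ℝ, a ⬝ᵥ g *ᵥ a = 0 → a = 0
  swap
  -- For other matrices the assertion is empty and 0 is a default value; thus the function can later
  -- be chosen for all matrices at once.
  · exact ⟨0, fun h1 h2 => absurd ⟨h1, h2⟩ hg⟩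
  let P := {p : Fin k × Fin k // p.1 < p.2}
  let low : (P → ℝ) →ₗ[ℝ] Matrix (Fin k) (Fin k) ℝ :=
    { toFun := fun x => Matrix.of fun i j => if h : j < i then x ⟨(j, i), h⟩ else 0
      map_add' := fun x y => by
        ext i j
        by_cases h : j < i <;> simp [h]
      map_smul' := fun r x => by
        ext i j
        by_cases h : j < i <;> simp [h] }
  let up : ((P → ℝ) × (Fin k → ℝ)) →ₗ[ℝ] Matrix (Fin k) (Fin k) ℝ :=
    { toFun := fun x => Matrix.of fun i j =>
        if h : i < j then x.1 ⟨(i, j), h⟩ else if i = j then -x.2 i else 0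
      map_add' := fun x y => by
        ext i j
        by_cases h : i < j
        · simp [h]
        · by_cases h' : i = j <;> simp [h, h', add_comm]
      map_smul' := fun r x => by
        ext i j
        by_cases h : i < j
        · simp [h]
        · by_cases h' : i = j <;> simp [h, h'] }
  let asym : Matrix (Fin k) (Fin k) ℝ →ₗ[ℝ] (P → ℝ) :=
    { toFun := fun Z p => (g * Z) p.1.1 p.1.2 - (g * Z) p.1.2 p.1.1
      map_add' := fun x y => by
        ext p
        simp only [Matrix.mul_add, Matrix.add_apply, Pi.add_apply]
        ring
      map_smul' := fun r x => by
        ext p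
        simp only [Matrix.mul_smul, Matrix.smul_apply, Pi.smul_apply, smul_eq_mul,
          RingHom.id_apply]
        ring }
  have hasym : ∀ Z, asym Z = 0 ↔ (g * Z).IsSymm := fun Z => by
    constructor
    · intro h
      ext i j
      rw [transpose_apply]
      rcases lt_trichotomy i j with hij | rfl | hij
      · have := congrFun h ⟨(i, j), hij⟩
        exact (sub_eq_zero.mp this).symm
      · rfl
      · have := congrFun h ⟨(j, i), hij⟩
        exact sub_eq_zero.mp this
    · intro h
      ext p
      exact sub_eq_zero.mpr (h.apply _ _).symm
  -- The strictly lower entries and the conditions for g Z to be symmetric are indexed by the same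
  -- pairs, so injectivity of this endomorphism makes it invertible.
  have hinj : Function.Injective (asym ∘ₗ low) := by
    rw [injective_iff_map_eq_zero]
    intro x hx
    have := eq_zero_of_strictlyLower_of_symm hg.1 hg.2 (L := low x)
      (fun i j hij => dif_neg (not_lt.mpr hij)) ((hasym _).mp hx)
    ext p
    have h' := congrFun (congrFun this p.1.2) p.1.1
    change (if h : p.1.1 < p.1.2 then x ⟨(p.1.1, p.1.2), h⟩ else 0) = 0 at h'
    rwa [dif_pos p.2] at h'
  let Φ := LinearEquiv.ofInjectiveEndo (asym ∘ₗ low) hinj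
  let F : Fin k → Fin k → ((P → ℝ) × (Fin k → ℝ)) →ₗ[ℝ] ℝ := fun i j => if h : i < j then
    -(LinearMap.proj (⟨(i, j), h⟩ : P) ∘ₗ Φ.symm.toLinearMap ∘ₗ asym ∘ₗ up) else 0
  have hF : ∀ i j (h : i < j) x, F i j x = (-Φ.symm (asym (up x))) ⟨(i, j), h⟩ := fun i j h x => by
    simp only [F, dif_pos h]
    rfl
  refine ⟨F, fun _ _ Z => ?_⟩
  have hZ : Z = up (fun p => Z p.1.1 p.1.2, fun i => -Z i i) + low (fun p => Z p.1.2 p.1.1) := by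
    ext i j
    simp only [up, low, LinearMap.coe_mk, AddHom.coe_mk, Matrix.add_apply, Matrix.of_apply]
    rcases lt_trichotomy i j with hij | rfl | hij
    · simp [hij, hij.not_gt]
    · simp
    · simp [hij, hij.not_gt, hij.ne']
  rw [← hasym]
  conv_lhs => rw [hZ, map_add, add_comm, add_eq_zero_iff_eq_neg]
  have h1 : ∀ y z, asym (low y) = -z ↔ y = -Φ.symm z := fun y z => by
    rw [← map_neg, LinearEquiv.eq_symm_apply]
    rfl
  rw [h1, funext_iff]
  constructor
  · intro h i j hij
    rw [hF i j hij]
    exact h ⟨(i, j), hij⟩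
  · rintro h ⟨⟨i, j⟩, hij⟩
    exact (h i j hij).trans (hF i j hij _)

end TriangularCompletion


/-! ### Components in adapted coordinates. -/

noncomputable section Components

open Matrix (vecCons)
open AlternatingMap

theorem exists_eq_comp_perm {a : ℕ} {β : Type*} (g I : Fin a → β) (hI : Function.Injective I)
    (h : ∀ k, ∃ l, g l = I k) : ∃ σ : Equiv.Perm (Fin a), I = g ∘ σ := by
  choose s hs using h
  have hinj : Function.Injective s := fun k l hkl => hI (by rw [← hs, ← hs, hkl])
  exact ⟨Equiv.ofBijective s (Finite.injective_iff_bijective.mp hinj), funext fun k => (hs k).symm⟩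

theorem exists_lowerIndices_eq {n : ℕ} (ν : Fin (n + 2)) (i : Fin (n + 3))
    (h : i ≠ Fin.last (n + 2)) (h' : i ≠ ν.castSucc) : ∃ l, lowerIndices ν l = i := by
  rcases Fin.eq_castSucc_or_eq_last i with ⟨i, rfl⟩ | rfl
  · obtain ⟨l, rfl⟩ := Fin.exists_succAbove_eq (x := i) (y := ν) fun hi => h' (by rw [hi])
    exact ⟨l, rfl⟩
  · exact absurd rfl h

theorem exists_upperIndices_eq {n : ℕ} (μ ν : Fin (n + 2)) (i : Fin (n + 4))
    (h : i ≠ μ.castSucc.castSucc) : ∃ l, upperIndices μ ν l = i := by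
  rcases Fin.eq_castSucc_or_eq_last i with ⟨i, rfl⟩ | rfl
  · rcases Fin.eq_castSucc_or_eq_last i with ⟨i, rfl⟩ | rfl
    · have hi : Equiv.swap μ ν i ≠ ν := fun hi => h (by
        rw [Equiv.swap_apply_eq_iff, Equiv.swap_apply_right] at hi
        rw [hi])
      obtain ⟨l, hl⟩ := Fin.exists_succAbove_eq hi
      refine ⟨l.succ.succ, ?_⟩
      simp [upperIndices, hl]
    · exact ⟨1, rfl⟩
  · exact ⟨0, rfl⟩

variable {T V : Type*} [AddCommGroup T] [Module ℝ T] [AddCommGroup V] [Module ℝ V] {n : ℕ}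

theorem injective_of_map_vecCons_ne_zero {N : Type*} [AddCommGroup N] [Module ℝ N] {k : ℕ}
    {ι : Type*} (f : T [⋀^Fin (k + 1)]→ₗ[ℝ] N) (d : ι → T) (x : T) (I : Fin k → ι)
    (h : f (vecCons x fun l => d (I l)) ≠ 0) : Function.Injective I ∧ ∀ l, d (I l) ≠ x := by
  constructor
  · intro l l' hl
    by_contra hne
    exact h (f.map_eq_zero_of_eq _ (i := l.succ) (j := l'.succ) (by simp [hl])
      fun h => hne (Fin.succ_injective _ h))
  · intro l hl
    exact h (f.map_eq_zero_of_eq _ (i := 0) (j := l.succ) (by simp [hl]) (Fin.succ_ne_zero _).symm)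

theorem biForm_ext_component {i j m k : ℕ} (d : Basis (Fin m) ℝ T) (b : Basis (Fin k) ℝ V)
    {τ τ' : BiForm T V i j} (h : ∀ I J, component d b τ I J = component d b τ' I J) : τ = τ' := by
  refine Basis.ext_alternating d fun I _ => Basis.ext_alternating b.dualBasis fun J _ => ?_
  simpa [component] using h I J

theorem component_perm {i j : ℕ} {ι κ : Type*} (d : ι → T) (b : Basis κ ℝ V) (τ : BiForm T V i j)
    (I : Fin i → ι) (J : Fin j → κ) (σ : Equiv.Perm (Fin i)) (ρ : Equiv.Perm (Fin j)) :
    component d b τ (I ∘ σ) (J ∘ ρ) =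
      ((Equiv.Perm.sign σ : ℤ) : ℝ) * ((Equiv.Perm.sign ρ : ℤ) : ℝ) * component d b τ I J := by
  change τ ((fun k => d (I k)) ∘ σ) ((fun k => b.coord (J k)) ∘ ρ) = _
  rw [map_perm, map_perm, Units.smul_def, Units.smul_def, ← Int.cast_smul_eq_zsmul ℝ,
    ← Int.cast_smul_eq_zsmul ℝ, AlternatingMap.smul_apply, smul_eq_mul, smul_eq_mul]
  simp only [component]
  ring

variable (d : Fin (n + 3) → T) (b : Basis (Fin (n + 4)) ℝ V)
  (Ω : T [⋀^Fin (n + 3)]→ₗ[ℝ] ℝ) (W : Dual ℝ V [⋀^Fin (n + 4)]→ₗ[ℝ] ℝ)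

/-- The form with components `X` and `Y` given (up to sign and a common factor) by `A`. -/
def coordStarSum (A : Matrix (Fin (n + 2)) (Fin (n + 2)) ℝ) : BiForm T V (n + 1) (n + 3) :=
  starSum Ω W (d (Fin.last (n + 2))) (fun j => d j.castSucc)
    (fun a => b.coord a.castSucc.castSucc) A

/-- The common factor of the components `X` and `Y` of `coordStarSum`. -/
def coordStarFactor : ℝ :=
  Ω (vecCons (d (Fin.last (n + 2))) fun j => d j.castSucc) *
    W (vecCons (b.coord (Fin.last (n + 3))) (vecCons (b.coord (Fin.last (n + 2)).castSucc)
      fun a : Fin (n + 2) => b.coord a.castSucc.castSucc))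

/-- The lower indices leave only the term j = ν and the upper ones only a = μ. Reinserting the
missing entries costs (-1)^ν twice, so what remains is the sign of the transposition; it makes X and
Y differ in sign. -/
theorem component_coordStarSum (A : Matrix (Fin (n + 2)) (Fin (n + 2)) ℝ) (μ ν : Fin (n + 2)) :
    component d b (coordStarSum d b Ω W A) (lowerIndices ν) (upperIndices μ ν) =
      ((Equiv.Perm.sign (Equiv.swap μ ν) : ℤ) : ℝ) * coordStarFactor d b Ω W * A ν μ := by
  let Y : Fin (n + 2) → T := fun j => d j.castSucc
  let C : Fin (n + 2) → Dual ℝ V := fun a => b.coord a.castSucc.castSucc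
  have hJ : (fun k => b.coord (upperIndices μ ν k)) =
      vecCons (b.coord (Fin.last (n + 3))) (vecCons (b.coord (Fin.last (n + 2)).castSucc)
        (ν.removeNth (C ∘ Equiv.swap μ ν))) := by
    funext k
    refine Fin.cases rfl (fun k => Fin.cases rfl (fun k => rfl) k) k
  let f := Ω.curryLeft (d (Fin.last (n + 2)))
  let f' := (W.curryLeft (b.coord (Fin.last (n + 3)))).curryLeft
    (b.coord (Fin.last (n + 2)).castSucc)
  have h1 : ∀ j, Ω (vecCons (d (Fin.last (n + 2))) (vecCons (Y j) fun k => d (lowerIndices ν k))) =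
      if j = ν then (-1) ^ (ν : ℕ) * f Y else 0 := fun j => by
    split_ifs with hj
    · subst hj
      exact map_vecCons_removeNth f j Y
    · obtain ⟨l, rfl⟩ := Fin.exists_succAbove_eq hj
      exact f.map_eq_zero_of_eq _ (i := 0) (j := l.succ) rfl (Fin.succ_ne_zero _).symm
  have h2 : ∀ a, W (vecCons (C a) fun k => b.coord (upperIndices μ ν k)) =
      if a = μ then (-1) ^ (ν : ℕ) * (((Equiv.Perm.sign (Equiv.swap μ ν) : ℤ) : ℝ) * f' C)
        else 0 := fun a => by
    rw [hJ, map_vecCons_swap]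
    have h3 := map_vecCons_swap (W.curryLeft (b.coord (Fin.last (n + 3)))) (C a)
      (b.coord (Fin.last (n + 2)).castSucc) (ν.removeNth (C ∘ Equiv.swap μ ν))
    rw [curryLeft_apply_apply] at h3
    rw [h3, neg_neg]
    change f' (vecCons (C a) _) = _
    split_ifs with ha
    · subst ha
      have h4 := map_vecCons_removeNth f' ν (C ∘ Equiv.swap a ν)
      rw [Function.comp_apply, Equiv.swap_apply_right, map_perm, Units.smul_def,
        ← Int.cast_smul_eq_zsmul ℝ] at h4
      exact h4
    · have : Equiv.swap μ ν a ≠ ν := fun h => ha (by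
        rwa [Equiv.swap_apply_eq_iff, Equiv.swap_apply_right] at h)
      obtain ⟨l, hl⟩ := Fin.exists_succAbove_eq this
      refine f'.map_eq_zero_of_eq _ (i := 0) (j := l.succ) ?_ (Fin.succ_ne_zero _).symm
      simp [Fin.removeNth, hl]
  have h3 : component d b (coordStarSum d b Ω W A) (lowerIndices ν) (upperIndices μ ν) =
      ∑ j, ∑ a, A j a * (Ω (vecCons (d (Fin.last (n + 2)))
        (vecCons (Y j) fun k => d (lowerIndices ν k))) *
        W (vecCons (C a) fun k => b.coord (upperIndices μ ν k))) := starSum_apply ..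
  rw [h3]
  simp only [h1, h2]
  have hsq : ((-1 : ℝ) ^ (ν : ℕ)) * (-1) ^ (ν : ℕ) = 1 := by rw [← mul_pow]; simp
  simp only [ite_mul, mul_ite, zero_mul, mul_zero, Finset.sum_ite_eq', Finset.mem_univ, if_true]
  change _ = ((Equiv.Perm.sign (Equiv.swap μ ν) : ℤ) : ℝ) * (f Y * f' C) * A ν μ
  linear_combination (A ν μ * (f Y * (((Equiv.Perm.sign (Equiv.swap μ ν) : ℤ) : ℝ) * f' C))) * hsq

theorem compY_coordStarSum (A : Matrix (Fin (n + 2)) (Fin (n + 2)) ℝ) (ν : Fin (n + 2)) :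
    compY d b (coordStarSum d b Ω W A) ν = coordStarFactor d b Ω W * A ν ν := by
  rw [compY, component_coordStarSum]
  simp

theorem compX_coordStarSum (A : Matrix (Fin (n + 2)) (Fin (n + 2)) ℝ) {μ ν : Fin (n + 2)}
    (h : μ ≠ ν) :
    compX d b (coordStarSum d b Ω W A) μ ν = -(coordStarFactor d b Ω W * A ν μ) := by
  rw [compX, component_coordStarSum, Equiv.Perm.sign_swap h]
  simp

/-- A nonzero term forces the lower indices to be distinct and to avoid N-1 and some ν, and the
upper ones to be distinct and to avoid some μ. Counting leaves only permutations of the standard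
index lists. -/
theorem isXYIndex_of_component_coordStarSum_ne_zero (A : Matrix (Fin (n + 2)) (Fin (n + 2)) ℝ)
    (I : Fin (n + 1) → Fin (n + 3)) (J : Fin (n + 3) → Fin (n + 4))
    (h : component d b (coordStarSum d b Ω W A) I J ≠ 0) : IsXYIndex I J := by
  have h3 : component d b (coordStarSum d b Ω W A) I J =
      ∑ j : Fin (n + 2), ∑ a : Fin (n + 2), A j a * (Ω (vecCons (d (Fin.last (n + 2)))
        (vecCons (d j.castSucc) fun k => d (I k))) *
        W (vecCons (b.coord a.castSucc.castSucc) fun k => b.coord (J k))) := starSum_apply ..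
  rw [h3] at h
  obtain ⟨ν, _, h⟩ := Finset.exists_ne_zero_of_sum_ne_zero h
  obtain ⟨μ, _, h⟩ := Finset.exists_ne_zero_of_sum_ne_zero h
  have hΩ := left_ne_zero_of_mul (right_ne_zero_of_mul h)
  have hW := right_ne_zero_of_mul (right_ne_zero_of_mul h)
  obtain ⟨hI, hI1⟩ := injective_of_map_vecCons_ne_zero (Ω.curryLeft (d (Fin.last (n + 2)))) d
    (d ν.castSucc) I hΩ
  rw [map_vecCons_swap] at hΩ
  obtain ⟨-, hI2⟩ := injective_of_map_vecCons_ne_zero (Ω.curryLeft (d ν.castSucc)) d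
    (d (Fin.last (n + 2))) I (neg_ne_zero.mp hΩ)
  obtain ⟨hJ, hJ1⟩ := injective_of_map_vecCons_ne_zero W b.coord (b.coord μ.castSucc.castSucc) J hW
  obtain ⟨σ, hσ⟩ := exists_eq_comp_perm (lowerIndices ν) I hI fun k =>
    exists_lowerIndices_eq ν (I k) (fun h => hI2 k (by rw [h])) (fun h => hI1 k (by rw [h]))
  obtain ⟨ρ, hρ⟩ := exists_eq_comp_perm (upperIndices μ ν) J hJ fun k =>
    exists_upperIndices_eq μ ν (J k) (fun h => hJ1 k (by rw [h]))
  exact ⟨μ, ν, σ, ρ, hσ, hρ⟩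

theorem exists_coordStarSum (hd : ∃ d' : Basis (Fin (n + 3)) ℝ T, ⇑d' = d)
    (hκ : coordStarFactor d b Ω W ≠ 0) (τ : BiForm T V (n + 1) (n + 3))
    (hτ : ∀ I J, component d b τ I J ≠ 0 → IsXYIndex I J) :
    ∃ A, τ = coordStarSum d b Ω W A := by
  have hs : ∀ μ ν : Fin (n + 2), ((Equiv.Perm.sign (Equiv.swap μ ν) : ℤ) : ℝ) ≠ 0 := fun μ ν => by
    rcases Int.units_eq_one_or (Equiv.Perm.sign (Equiv.swap μ ν)) with h | h <;> simp [h]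
  let A : Matrix (Fin (n + 2)) (Fin (n + 2)) ℝ := Matrix.of fun ν μ =>
    (((Equiv.Perm.sign (Equiv.swap μ ν) : ℤ) : ℝ) * coordStarFactor d b Ω W)⁻¹ *
      component d b τ (lowerIndices ν) (upperIndices μ ν)
  refine ⟨A, ?_⟩
  obtain ⟨d', rfl⟩ := hd
  refine biForm_ext_component d' b fun I J => ?_
  by_cases h : IsXYIndex I J
  · obtain ⟨μ, ν, σ, ρ, rfl, rfl⟩ := h
    rw [component_perm, component_perm, component_coordStarSum]
    congr 1
    simp only [A, Matrix.of_apply]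
    rw [mul_inv_cancel_left₀ (mul_ne_zero (hs μ ν) hκ)]
  · rw [not_ne_iff.mp (mt (hτ I J) h),
      not_ne_iff.mp (mt (isXYIndex_of_component_coordStarSum_ne_zero d' b Ω W A I J) h)]

end Components


/-! ### The fibre at a light-like point: matrices and components. -/

noncomputable section LightLike

open Matrix (vecCons)
open AlternatingMap

variable {T V : Type*} [AddCommGroup T] [Module ℝ T] [AddCommGroup V] [Module ℝ V] {n : ℕ}

/-- The data at a point of a light-like boundary: a null vector `x` and `e' = e - β ⊗ e x`, where
`β x = 1`. -/
structure IsLightLike (n : ℕ) (η : V →ₗ[ℝ] Dual ℝ V) (e e' : T →ₗ[ℝ] V) (x : T) (β : Dual ℝ T) :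
    Prop where
  lorentzian : IsLorentzian (n + 3) η
  injective : Function.Injective e
  null (u : T) : η (e x) (e u) = 0
  apply_null : β x = 1
  modified_apply (u : T) : e' u = e u - β u • e x

namespace IsLightLike

variable {η : V →ₗ[ℝ] Dual ℝ V} {e e' : T →ₗ[ℝ] V} {x : T} {β : Dual ℝ T}

theorem modified_null (h : IsLightLike n η e e' x β) : e' x = 0 := by
  rw [h.modified_apply, h.apply_null, one_smul, sub_self]

theorem metric_modified_left (h : IsLightLike n η e e' x β) (u v : T) :
    η (e' u) (e v) = η (e u) (e v) := by
  rw [h.modified_apply, map_sub, map_smul, LinearMap.sub_apply, LinearMap.smul_apply, h.null,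
    smul_zero, sub_zero]

theorem metric_modified (h : IsLightLike n η e e' x β) (u v : T) :
    η (e' u) (e' v) = η (e u) (e v) := by
  rw [h.modified_apply v, map_sub, map_smul, h.metric_modified_left, h.metric_modified_left,
    h.lorentzian.symm (e u) (e x), h.null, smul_zero, sub_zero]

theorem ne_zero (h : IsLightLike n η e e' x β) : x ≠ 0 := by
  rintro rfl
  simpa using h.apply_null

/-- The null direction is unique, so every null vector, and in particular ∂_{N-1}, is a multiple of
x. This permits using either one in the description of the fibre. -/
theorem modified_eq_zero (h : IsLightLike n η e e' x β) {y : T} (hy : ∀ u, η (e y) (e u) = 0) :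
    e' y = 0 := by
  obtain ⟨r, rfl⟩ := h.lorentzian.exists_smul_of_null h.injective h.ne_zero h.null (hy y)
  rw [map_smul, h.modified_null, smul_zero]

variable {k : ℕ} {y : T} {Y : Fin k → T}

/-- The Gram matrix of the boundary metric. -/
def gram (η : V →ₗ[ℝ] Dual ℝ V) (e : T →ₗ[ℝ] V) (Y : Fin k → T) : Matrix (Fin k) (Fin k) ℝ :=
  Matrix.of fun i j => η (e (Y i)) (e (Y j))

theorem gram_isSymm (h : IsLightLike n η e e' x β) : (gram η e Y).IsSymm := by
  ext i j
  exact h.lorentzian.symm _ _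

theorem gram_definite (h : IsLightLike n η e e' x β) (hy : ∀ u, η (e y) (e u) = 0)
    (hY : LinearIndependent ℝ (vecCons y Y)) (a : Fin k → ℝ)
    (ha : a ⬝ᵥ (gram η e Y).mulVec a = 0) : a = 0 := by
  refine h.lorentzian.gram_definite h.injective hY hy a ?_
  rw [← ha]
  simp only [map_sum, map_smul, LinearMap.sum_apply, LinearMap.smul_apply, smul_eq_mul, gram,
    dotProduct, Matrix.mulVec, Matrix.of_apply, mul_comm]
  refine Finset.sum_congr rfl fun i _ => congrArg _ (Finset.sum_congr rfl fun j _ => ?_)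
  rw [h.lorentzian.symm]

theorem isUnit_gram (h : IsLightLike n η e e' x β) (hy : ∀ u, η (e y) (e u) = 0)
    (hY : LinearIndependent ℝ (vecCons y Y)) : IsUnit (gram η e Y) := by
  rw [← Matrix.mulVec_injective_iff_isUnit, ← Matrix.coe_mulVecLin, injective_iff_map_eq_zero]
  intro a ha
  refine h.gram_definite hy hY a ?_
  rw [Matrix.mulVecLin_apply] at ha
  rw [ha, dotProduct_zero]

theorem linearIndependent_metric (h : IsLightLike n η e e' x β) (hy : ∀ u, η (e y) (e u) = 0)
    (hY : LinearIndependent ℝ (vecCons y Y)) :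
    LinearIndependent ℝ fun ν => η (e' (Y ν)) := by
  rw [Fintype.linearIndependent_iff]
  intro a ha
  refine congrFun (h.lorentzian.gram_definite h.injective hY hy a ?_)
  have := LinearMap.congr_fun ha (e (∑ i, a i • Y i))
  simp only [LinearMap.sum_apply, LinearMap.smul_apply, h.metric_modified_left,
    LinearMap.zero_apply] at this
  rw [← this]
  conv_lhs => rw [map_sum e, map_sum η]
  simp only [map_sum, map_smul, LinearMap.sum_apply, LinearMap.smul_apply, smul_eq_mul]
  refine Finset.sum_congr rfl fun i _ => congrArg _ (Finset.sum_congr rfl fun j _ => ?_)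
  rw [h.lorentzian.symm]

/-- The elements of the fibre of `𝒮` correspond to symmetric matrices with vanishing trace. -/
theorem mem_degeneracyFibre_iff (h : IsLightLike n η e e' x β) {y : T} {Y : Fin (n + 2) → T}
    (hy : ∀ u, η (e y) (e u) = 0) (d : Basis (Fin (n + 3)) ℝ T) (hd : ⇑d = vecCons y Y)
    (c : Basis (Fin (n + 4)) ℝ (Dual ℝ V)) (Ω : T [⋀^Fin (n + 3)]→ₗ[ℝ] ℝ) (hΩ : Ω d ≠ 0)
    (W : Dual ℝ V [⋀^Fin (n + 4)]→ₗ[ℝ] ℝ) (hW : W c ≠ 0) {τ : BiForm T V (n + 1) (n + 3)} :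
    τ ∈ degeneracyFibre n η e e' ↔ ∃ B : Matrix (Fin (n + 2)) (Fin (n + 2)) ℝ,
      B.IsSymm ∧ (B * gram η e Y).trace = 0 ∧ τ = starSum Ω W y Y (fun ν => η (e' (Y ν))) B := by
  have hG : ∀ B : Matrix (Fin (n + 2)) (Fin (n + 2)) ℝ, (B * gram η e Y).trace =
      ∑ j, ∑ ν, B j ν * η (e' (Y ν)) (e (Y j)) := fun B => by
    simp only [Matrix.trace, Matrix.diag_apply, Matrix.mul_apply, gram, Matrix.of_apply,
      h.metric_modified_left]
  have hy' := h.modified_eq_zero hy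
  constructor
  · intro hτ
    obtain ⟨B, hB, htr, hτ⟩ := exists_starSum_of_mem_degeneracyFibre d c Ω hΩ W hW η e e' y Y hd
      hy' (h.linearIndependent_metric hy (hd ▸ d.linearIndependent)) hτ
    exact ⟨B, hB, (hG B).trans htr, hτ⟩
  · rintro ⟨B, hB, htr, rfl⟩
    refine starSum_mem_degeneracyFibre d c Ω W η e e' y Y hy' (fun ν => ?_) B hB
      ((hG B).symm.trans htr)
    rw [h.metric_modified_left, h.lorentzian.symm, hy]

end IsLightLike

/-- A linear substitution of the covectors is absorbed in the matrix; this turns B into B G when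
passing to the dual basis. -/
theorem starSum_sum {k : ℕ} (Ω : T [⋀^Fin (n + 3)]→ₗ[ℝ] ℝ) (W : Dual ℝ V [⋀^Fin (k + 2)]→ₗ[ℝ] ℝ)
    (x : T) (Y : Fin (n + 2) → T) (θ : Fin (n + 2) → Dual ℝ V)
    (B G : Matrix (Fin (n + 2)) (Fin (n + 2)) ℝ) :
    starSum Ω W x Y (fun ν => ∑ a, G ν a • θ a) B = starSum Ω W x Y θ (B * G) := by
  ext u ξ
  rw [starSum_apply, starSum_apply]
  refine Finset.sum_congr rfl fun j _ => ?_
  simp only [map_vecCons_sum, Matrix.mul_apply, Finset.mul_sum, Finset.sum_mul, smul_eq_mul]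
  rw [Finset.sum_comm]
  exact Finset.sum_congr rfl fun a _ => Finset.sum_congr rfl fun ν _ => by ring

theorem IsLightLike.mem_degeneracyFibre_iff_component {η : V →ₗ[ℝ] Dual ℝ V} {e e' : T →ₗ[ℝ] V}
    {x : T} {β : Dual ℝ T} (h : IsLightLike n η e e' x β) (hT : finrank ℝ T = n + 3)
    (d : Fin (n + 3) → T) (b : Basis (Fin (n + 4)) ℝ V) (hb : ∀ i, b i.castSucc = e (d i))
    (hd : ∀ u, η (e (d (Fin.last (n + 2)))) (e u) = 0)
    (hbl : ∀ u, η (b (Fin.last (n + 3))) (e' u) = 0)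
    (F : Fin (n + 2) → Fin (n + 2) →
        (({p : Fin (n + 2) × Fin (n + 2) // p.1 < p.2} → ℝ) × (Fin (n + 2) → ℝ)) →ₗ[ℝ] ℝ)
    (hF : ∀ Z : Matrix (Fin (n + 2)) (Fin (n + 2)) ℝ,
      (gram η e (fun j : Fin (n + 2) => d j.castSucc) * Z).IsSymm ↔ ∀ i j, i < j →
          Z j i = F i j (fun p => Z p.1.1 p.1.2, fun i => -Z i i))
    (τ : BiForm T V (n + 1) (n + 3)) :
    τ ∈ degeneracyFibre n η e e' ↔
      (∀ I J, component d b τ I J ≠ 0 → IsXYIndex I J) ∧ ∑ μ, compY d b τ μ = 0 ∧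
        ∀ μ₁ μ₂ : Fin (n + 2), μ₁ < μ₂ → compX d b τ μ₁ μ₂ =
          F μ₁ μ₂ (fun p => compX d b τ p.1.2 p.1.1, compY d b τ) := by
  set Y : Fin (n + 2) → T := fun j => d j.castSucc with hYdef
  set y := d (Fin.last (n + 2)) with hydef
  have hli : LinearIndependent ℝ d := by
    refine LinearIndependent.of_comp e ?_
    have := b.linearIndependent.comp Fin.castSucc (Fin.castSucc_injective _)
    convert this using 1
    funext i
    exact (hb i).symm
  have : Nonempty (Fin (n + 3)) := ⟨0⟩
  let d' : Basis (Fin (n + 3)) ℝ T :=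
    basisOfLinearIndependentOfCardEqFinrank hli (by rw [hT, Fintype.card_fin])
  have hd' : ⇑d' = d := coe_basisOfLinearIndependentOfCardEqFinrank _ _
  -- The rotation puts the null vector ∂_{N-1} first.
  let D := d'.reindex (finRotate (n + 3))
  have hD : ⇑D = vecCons y Y := by
    funext i
    rw [Basis.reindex_apply, hd']
    refine Fin.cases ?_ (fun i => ?_) i
    · rw [(Equiv.symm_apply_eq _).mpr (finRotate_last (n := n + 2)).symm]
      rfl
    · have : finRotate (n + 3) i.castSucc = i.succ := by
        rw [finRotate_apply]
        exact Fin.coeSucc_eq_succ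
      rw [(Equiv.symm_apply_eq _).mpr this.symm]
      rfl
  have hyY : LinearIndependent ℝ (vecCons y Y) := hD ▸ D.linearIndependent
  let c := b.dualBasis
  have hc : ∀ i, c i = b.coord i := fun i => congrFun b.coe_dualBasis i
  set Ω := D.det with hΩdef
  set W := c.det with hWdef
  have hΩ : Ω D ≠ 0 := by rw [hΩdef, D.det_self]; exact one_ne_zero
  have hW : W c ≠ 0 := by rw [hWdef, c.det_self]; exact one_ne_zero
  set κ := coordStarFactor d b Ω W with hκdef
  have hκ : κ ≠ 0 := by
    refine mul_ne_zero (hD ▸ hΩ) ?_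
    let J : Fin (n + 4) → Fin (n + 4) := Fin.cons (Fin.last (n + 3))
      (Fin.cons (Fin.last (n + 2)).castSucc fun a : Fin (n + 2) => a.castSucc.castSucc)
    have hJ : Function.Injective J := by
      refine Fin.cons_injective_iff.mpr ⟨?_, Fin.cons_injective_iff.mpr ⟨?_, ?_⟩⟩
      · rintro ⟨k, hk⟩
        revert hk
        refine Fin.cases ?_ (fun k => ?_) k
        · exact fun hk => Fin.castSucc_ne_last _ hk
        · exact fun hk => Fin.castSucc_ne_last _ hk
      · rintro ⟨k, hk⟩
        exact Fin.castSucc_ne_last _ (Fin.castSucc_injective _ hk)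
      · exact (Fin.castSucc_injective _).comp (Fin.castSucc_injective _)
    let σ : Equiv.Perm (Fin (n + 4)) := Equiv.ofBijective J (Finite.injective_iff_bijective.mp hJ)
    have hσ : (vecCons (b.coord (Fin.last (n + 3))) (vecCons (b.coord (Fin.last (n + 2)).castSucc)
        fun a : Fin (n + 2) => b.coord a.castSucc.castSucc)) = c ∘ σ := by
      funext k
      rw [Function.comp_apply, hc]
      exact Fin.cases rfl (fun k => Fin.cases rfl (fun k => rfl) k) k
    rw [hσ, map_perm]
    rcases Int.units_eq_one_or (Equiv.Perm.sign σ) with h | h <;> simp [h, hW]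
  set G := gram η e Y with hGdef
  have hG := h.isUnit_gram hd hyY
  have hGs : G.IsSymm := h.gram_isSymm
  rw [← hGdef, Matrix.isUnit_iff_isUnit_det] at hG
  -- θ_ν has no coefficient at e^{N-1}, since ∂_{N-1} is null, and none at e^N, by the choice of
  -- e_N; the remaining ones form the Gram matrix.
  have hθ : (fun ν => η (e' (Y ν))) =
      fun ν => ∑ a, G ν a • b.coord (Fin.castSucc (Fin.castSucc a)) := by
    funext ν
    refine b.ext fun i => ?_
    rw [LinearMap.sum_apply]
    simp only [LinearMap.smul_apply, Basis.coord_apply, Basis.repr_self, smul_eq_mul,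
      Finsupp.single_apply]
    rcases Fin.eq_castSucc_or_eq_last i with ⟨i, rfl⟩ | rfl
    · rcases Fin.eq_castSucc_or_eq_last i with ⟨i, rfl⟩ | rfl
      · rw [hb, h.metric_modified_left]
        simp [hGdef, gram, hYdef]
      · rw [hb, h.metric_modified_left, h.lorentzian.symm, hd]
        symm
        refine Finset.sum_eq_zero fun a _ => ?_
        rw [if_neg fun h => Fin.castSucc_ne_last _ (Fin.castSucc_injective _ h).symm, mul_zero]
    · rw [h.lorentzian.symm, hbl]
      symm
      refine Finset.sum_eq_zero fun a _ => ?_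
      rw [if_neg (Fin.castSucc_ne_last _).symm, mul_zero]
  -- The matrix -κ A has the components X off the diagonal and -Y on it, and scaling by κ ≠ 0 does
  -- not affect the symmetry of G A.
  have hcompF : ∀ A, (∀ μ₁ μ₂ : Fin (n + 2), μ₁ < μ₂ →
      compX d b (coordStarSum d b Ω W A) μ₁ μ₂ = F μ₁ μ₂
        (fun p => compX d b (coordStarSum d b Ω W A) p.1.2 p.1.1,
          compY d b (coordStarSum d b Ω W A))) ↔ (G * A).IsSymm := fun A => by
    have h1 : (G * A).IsSymm ↔ (G * (-κ • A)).IsSymm := by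
      rw [Matrix.mul_smul]
      refine ⟨fun hA => hA.smul _, fun hA => ?_⟩
      have := hA.smul (-κ)⁻¹
      rwa [smul_smul, inv_mul_cancel₀ (neg_ne_zero.mpr hκ), one_smul] at this
    rw [h1, hF]
    have h2 : (fun p : {p : Fin (n + 2) × Fin (n + 2) // p.1 < p.2} =>
        compX d b (coordStarSum d b Ω W A) p.1.2 p.1.1) =
        fun p => (-κ • A) p.1.1 p.1.2 := by
      funext p
      rw [compX_coordStarSum d b Ω W A p.2.ne', Matrix.smul_apply, smul_eq_mul, neg_mul]
    have h3 : compY d b (coordStarSum d b Ω W A) = fun i => -(-κ • A) i i := by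
      funext i
      rw [compY_coordStarSum, Matrix.smul_apply, smul_eq_mul, neg_mul, neg_neg]
    rw [h2, h3]
    refine forall_congr' fun i => forall_congr' fun j => forall_congr' fun hij => ?_
    rw [compX_coordStarSum d b Ω W A hij.ne, Matrix.smul_apply, smul_eq_mul, neg_mul]
  have htr : ∀ A, ∑ μ, compY d b (coordStarSum d b Ω W A) μ = κ * A.trace := fun A => by
    simp only [compY_coordStarSum, Matrix.trace, Matrix.diag_apply, Finset.mul_sum, hκdef]
  rw [h.mem_degeneracyFibre_iff hd D hD c Ω hΩ W hW, hθ]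
  simp only [starSum_sum]
  constructor
  · rintro ⟨B, hB, hBt, rfl⟩
    refine ⟨isXYIndex_of_component_coordStarSum_ne_zero d b Ω W _, ?_, ?_⟩
    · exact (htr _).trans (by rw [hBt, mul_zero])
    · refine (hcompF _).mpr ?_
      rw [Matrix.IsSymm, Matrix.transpose_mul, Matrix.transpose_mul, hGs.eq, hB.eq,
        Matrix.mul_assoc]
  · rintro ⟨hXY, hY0, hX⟩
    obtain ⟨A, rfl⟩ := exists_coordStarSum d b Ω W ⟨d', hd'⟩ hκ τ hXY
    have hA := (hcompF A).mp hX
    rw [Matrix.IsSymm, Matrix.transpose_mul, hGs.eq] at hA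
    rw [htr] at hY0
    have hAG : A * G⁻¹ * G = A := Matrix.nonsing_inv_mul_cancel_right _ _ hG
    -- Inverse of B ↦ B G; A G⁻¹ = G⁻¹ (G A) G⁻¹ is symmetric together with G A.
    refine ⟨A * G⁻¹, ?_, ?_, ?_⟩
    · have hGi : G⁻¹.transpose = G⁻¹ := by rw [Matrix.transpose_nonsing_inv, hGs.eq]
      rw [Matrix.IsSymm, Matrix.transpose_mul, hGi]
      calc G⁻¹ * A.transpose = G⁻¹ * (A.transpose * G) * G⁻¹ := by
            rw [Matrix.mul_assoc, Matrix.mul_nonsing_inv_cancel_right _ _ hG]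
        _ = A * G⁻¹ := by rw [hA, Matrix.nonsing_inv_mul_cancel_left _ _ hG]
    · rw [hAG]
      exact (mul_eq_zero.mp hY0).resolve_left hκ
    · rw [hAG]
      rfl

end LightLike


/-! ### An explicit basis of the fibre. -/

noncomputable section FibreBasis

open Matrix (vecCons)
open AlternatingMap

/-- Unordered pairs index the entries of a symmetric matrix; the trace condition is solved for the
entry (0, 0), which removes one. -/
theorem card_sym2_ne (n : ℕ) : Fintype.card {z : Sym2 (Fin (n + 2)) // z ≠ s(0, 0)} =
    (n + 4) * (n + 1) / 2 := by
  rw [Fintype.card_subtype_compl (fun z : Sym2 (Fin (n + 2)) => z = s(0, 0)), Sym2.card,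
    Fintype.card_subtype_eq, Fintype.card_fin, Nat.choose_two_right]
  have : (n + 2 + 1) * (n + 2 + 1 - 1) = (n + 4) * (n + 1) + 2 := by
    rw [Nat.add_sub_cancel]
    ring
  omega

section TracelessBasis

variable {k : ℕ} (G : Matrix (Fin (k + 1)) (Fin (k + 1)) ℝ)

/-- A basis of the space of symmetric matrices `B` with `tr (B G) = 0`. -/
def tracelessBasis (z : Sym2 (Fin (k + 1))) : Matrix (Fin (k + 1)) (Fin (k + 1)) ℝ :=
  -- The symmetric unit at z is scaled by G₀₀, and a multiple of the unit at (0, 0) restores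
  -- vanishing trace. Scaling instead of dividing keeps the entries polynomial in G.
  Matrix.of fun i j => (if s(i, j) = z then G 0 0 else 0) -
    if s(i, j) = s(0, 0) then ∑ a, ∑ b, if s(a, b) = z then G a b else 0 else 0

theorem tracelessBasis_isSymm (z : Sym2 (Fin (k + 1))) : (tracelessBasis G z).IsSymm := by
  ext i j
  simp only [tracelessBasis, Matrix.transpose_apply, Matrix.of_apply, Sym2.eq_swap (a := j)]

theorem trace_tracelessBasis_mul (hG : G.IsSymm) (z : Sym2 (Fin (k + 1))) :
    (tracelessBasis G z * G).trace = 0 := by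
  simp only [Matrix.trace, Matrix.diag_apply, Matrix.mul_apply, tracelessBasis, Matrix.of_apply,
    sub_mul, Finset.sum_sub_distrib]
  rw [sub_eq_zero]
  have h1 : ∀ i j, (if s(i, j) = s(0, 0) then ∑ a, ∑ b, if s(a, b) = z then G a b else 0 else 0) *
      G j i = if i = 0 then (if j = 0 then
        (∑ a, ∑ b, if s(a, b) = z then G a b else 0) * G 0 0 else 0) else 0 := fun i j => by
    by_cases hi : i = 0
    · by_cases hj : j = 0
      · simp [hi, hj]
      · simp [hi, hj]
    · simp [hi]
  simp only [h1, Finset.sum_ite_eq', Finset.sum_ite_irrel, Finset.sum_const_zero,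
    Finset.mem_univ, if_true, Finset.sum_mul]
  refine Finset.sum_congr rfl fun i _ => Finset.sum_congr rfl fun j _ => ?_
  rw [hG.apply i j]
  split_ifs <;> ring

theorem sum_tracelessBasis_apply_of_ne (c : {z : Sym2 (Fin (k + 1)) // z ≠ s(0, 0)} → ℝ)
    (z : {z : Sym2 (Fin (k + 1)) // z ≠ s(0, 0)}) {i j : Fin (k + 1)} (h : s(i, j) = z.1) :
    (∑ z, c z • tracelessBasis G z.1) i j = c z * G 0 0 := by
  rw [Matrix.sum_apply, Finset.sum_eq_single_of_mem z (Finset.mem_univ z)]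
  · simp only [tracelessBasis, Matrix.smul_apply, Matrix.of_apply, h, if_true, if_neg z.2,
      sub_zero, smul_eq_mul]
  · intro z' _ hz'
    have h1 : z.1 ≠ z'.1 := fun h => hz' (Subtype.ext h.symm)
    simp only [tracelessBasis, Matrix.smul_apply, Matrix.of_apply, h, if_neg h1, if_neg z.2,
      sub_zero, smul_zero]

/-- Away from (0, 0) the entries can be compared directly; the entry (0, 0) then follows from the
trace condition. -/
theorem eq_sum_tracelessBasis (hG : G.IsSymm) (hG0 : G 0 0 ≠ 0)
    (B : Matrix (Fin (k + 1)) (Fin (k + 1)) ℝ) (hB : B.IsSymm) (htr : (B * G).trace = 0) :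
    B = ∑ z : {z : Sym2 (Fin (k + 1)) // z ≠ s(0, 0)},
      ((G 0 0)⁻¹ * B z.1.out.1 z.1.out.2) • tracelessBasis G z.1 := by
  have hrep : ∀ i j, B (s(i, j)).out.1 (s(i, j)).out.2 = B i j := fun i j => by
    have : s((s(i, j)).out.1, (s(i, j)).out.2) = s(i, j) := Quot.out_eq _
    rcases Sym2.eq_iff.mp this with ⟨h1, h2⟩ | ⟨h1, h2⟩
    · rw [h1, h2]
    · rw [h1, h2, hB.apply]
  ext i j
  by_cases h : s(i, j) = s(0, 0)
  · obtain ⟨rfl, rfl⟩ : i = 0 ∧ j = 0 := by simpa using h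
    have h1 : ∀ z : {z : Sym2 (Fin (k + 1)) // z ≠ s(0, 0)},
        (((G 0 0)⁻¹ * B z.1.out.1 z.1.out.2) • tracelessBasis G z.1) 0 0 =
        ∑ a, ∑ b, if s(a, b) = z.1 then -((G 0 0)⁻¹ * (B a b * G a b)) else 0 := fun z => by
      simp only [tracelessBasis, Matrix.smul_apply, Matrix.of_apply, if_neg z.2.symm, if_true,
        smul_eq_mul, zero_sub, mul_neg, Finset.mul_sum, ← Finset.sum_neg_distrib]
      refine Finset.sum_congr rfl fun a _ => Finset.sum_congr rfl fun b _ => ?_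
      split_ifs with hab
      · rw [← hab, hrep]
        ring
      · ring
    rw [Matrix.sum_apply]
    simp only [h1]
    rw [Finset.sum_comm]
    have h2 : ∀ a, (∑ z : {z : Sym2 (Fin (k + 1)) // z ≠ s(0, 0)},
        ∑ b, if s(a, b) = z.1 then -((G 0 0)⁻¹ * (B a b * G a b)) else 0) =
        ∑ b, if s(a, b) = s(0, 0) then 0 else -((G 0 0)⁻¹ * (B a b * G a b)) := fun a => by
      rw [Finset.sum_comm]
      refine Finset.sum_congr rfl fun b _ => ?_
      split_ifs with hab
      · exact Finset.sum_eq_zero fun z _ => if_neg fun h => z.2 (h.symm.trans hab)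
      · rw [Finset.sum_eq_single_of_mem ⟨s(a, b), hab⟩ (Finset.mem_univ _), if_pos rfl]
        exact fun z _ hz => if_neg fun h => hz (Subtype.ext h.symm)
    simp only [h2]
    have h3 : ∀ a b : Fin (k + 1),
        (if s(a, b) = s(0, 0) then 0 else -((G 0 0)⁻¹ * (B a b * G a b))) =
        (if a = 0 then (if b = 0 then B 0 0 else 0) else 0) -
          (G 0 0)⁻¹ * (B a b * G b a) := fun a b => by
      by_cases ha : a = 0
      · by_cases hb : b = 0
        · simp only [ha, hb, if_true]
          field_simp
          ring
        · simp [ha, hb, hG.apply]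
      · simp [ha, hG.apply]
    simp only [h3, Finset.sum_sub_distrib, ← Finset.mul_sum]
    have h4 : ∑ a, ∑ b, B a b * G b a = 0 := by
      rw [← htr]
      simp only [Matrix.trace, Matrix.diag_apply, Matrix.mul_apply]
    rw [h4]
    simp
  · rw [sum_tracelessBasis_apply_of_ne G _ ⟨s(i, j), h⟩ rfl, hrep]
    field_simp

theorem linearIndependent_tracelessBasis (hG0 : G 0 0 ≠ 0) :
    LinearIndependent ℝ fun z : {z : Sym2 (Fin (k + 1)) // z ≠ s(0, 0)} =>
      tracelessBasis G z.1 := by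
  rw [Fintype.linearIndependent_iff]
  intro c hc z
  have h := sum_tracelessBasis_apply_of_ne G c z (i := z.1.out.1) (j := z.1.out.2)
    (Quot.out_eq z.1)
  rw [hc, Matrix.zero_apply, eq_comm] at h
  exact (mul_eq_zero.mp h).resolve_right hG0

end TracelessBasis

variable {T V : Type*} [AddCommGroup T] [Module ℝ T] [AddCommGroup V] [Module ℝ V] {n : ℕ}

theorem starSum_add {k : ℕ} (Ω : T [⋀^Fin (n + 3)]→ₗ[ℝ] ℝ) (W : Dual ℝ V [⋀^Fin (k + 2)]→ₗ[ℝ] ℝ)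
    (x : T) (Y : Fin (n + 2) → T) (θ : Fin (n + 2) → Dual ℝ V)
    (B B' : Matrix (Fin (n + 2)) (Fin (n + 2)) ℝ) :
    starSum Ω W x Y θ (B + B') = starSum Ω W x Y θ B + starSum Ω W x Y θ B' := by
  simp only [starSum, Matrix.add_apply, add_smul, Finset.sum_add_distrib]

theorem starSum_smul {k : ℕ} (Ω : T [⋀^Fin (n + 3)]→ₗ[ℝ] ℝ) (W : Dual ℝ V [⋀^Fin (k + 2)]→ₗ[ℝ] ℝ)
    (x : T) (Y : Fin (n + 2) → T) (θ : Fin (n + 2) → Dual ℝ V) (r : ℝ)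
    (B : Matrix (Fin (n + 2)) (Fin (n + 2)) ℝ) :
    starSum Ω W x Y θ (r • B) = r • starSum Ω W x Y θ B := by
  simp only [starSum, Matrix.smul_apply, smul_assoc, Finset.smul_sum]

/-- `starSum` as a linear map. -/
def starSumₗ {k : ℕ} (Ω : T [⋀^Fin (n + 3)]→ₗ[ℝ] ℝ) (W : Dual ℝ V [⋀^Fin (k + 2)]→ₗ[ℝ] ℝ)
    (x : T) (Y : Fin (n + 2) → T) (θ : Fin (n + 2) → Dual ℝ V) :
    Matrix (Fin (n + 2)) (Fin (n + 2)) ℝ →ₗ[ℝ] BiForm T V (n + 1) (k + 1) where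
  toFun := starSum Ω W x Y θ
  map_add' := starSum_add Ω W x Y θ
  map_smul' := starSum_smul Ω W x Y θ

/-- The entries of `B` are values of `starSum B`. -/
theorem starSum_apply_removeNth (Ω : T [⋀^Fin (n + 3)]→ₗ[ℝ] ℝ)
    (W : Dual ℝ V [⋀^Fin (n + 4)]→ₗ[ℝ] ℝ) (x : T) (Y : Fin (n + 2) → T)
    (θ φ : Fin (n + 2) → Dual ℝ V) (κ ψ : Dual ℝ V) (r : Fin (n + 2) → ℝ)
    (hθ : ∀ ν, θ ν = φ ν - r ν • ψ) (B : Matrix (Fin (n + 2)) (Fin (n + 2)) ℝ)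
    (ν μ : Fin (n + 2)) :
    starSum Ω W x Y θ B (ν.removeNth Y) (vecCons κ (vecCons ψ (μ.removeNth φ))) =
      (-1) ^ (ν : ℕ) * (-1) ^ (μ : ℕ) * (Ω (vecCons x Y) * W (vecCons κ (vecCons ψ φ))) *
        B ν μ := by
  let f := Ω.curryLeft x
  let f' := (W.curryLeft κ).curryLeft ψ
  have h1 : ∀ j, Ω (vecCons x (vecCons (Y j) (ν.removeNth Y))) =
      if j = ν then (-1) ^ (ν : ℕ) * f Y else 0 := fun j => by
    split_ifs with hj
    · subst hj
      exact map_vecCons_removeNth f j Y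
    · obtain ⟨l, rfl⟩ := Fin.exists_succAbove_eq hj
      exact f.map_eq_zero_of_eq _ (i := 0) (j := l.succ) rfl (Fin.succ_ne_zero _).symm
  have h2 : ∀ a, W (vecCons (θ a) (vecCons κ (vecCons ψ (μ.removeNth φ)))) =
      if a = μ then (-1) ^ (μ : ℕ) * f' φ else 0 := fun a => by
    rw [map_vecCons_swap]
    have h3 := map_vecCons_swap (W.curryLeft κ) (θ a) ψ (μ.removeNth φ)
    rw [curryLeft_apply_apply] at h3
    rw [h3, neg_neg]
    have h4 : (W.curryLeft κ) (vecCons ψ (vecCons (θ a) (μ.removeNth φ))) =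
        -- θ_a and φ_a differ by a multiple of ψ, which is already an argument.
        f' (vecCons (φ a) (μ.removeNth φ)) := by
      have h5 : f'.curryLeft ψ (μ.removeNth φ) = 0 :=
        DFunLike.congr_fun ((W.curryLeft κ).curryLeft_same ψ) (μ.removeNth φ)
      change f'.curryLeft (θ a) (μ.removeNth φ) = f'.curryLeft (φ a) (μ.removeNth φ)
      rw [hθ, map_sub, map_smul, AlternatingMap.sub_apply, AlternatingMap.smul_apply, h5,
        smul_zero, sub_zero]
    rw [h4]
    split_ifs with ha
    · subst ha
      exact map_vecCons_removeNth f' a φ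
    · obtain ⟨l, rfl⟩ := Fin.exists_succAbove_eq ha
      exact f'.map_eq_zero_of_eq _ (i := 0) (j := l.succ) rfl (Fin.succ_ne_zero _).symm
  rw [starSum_apply]
  simp only [h1, h2, ite_mul, mul_ite, zero_mul, mul_zero, Finset.sum_ite_eq', Finset.mem_univ,
    if_true]
  change _ = (-1) ^ (ν : ℕ) * (-1) ^ (μ : ℕ) * (f Y * f' φ) * B ν μ
  ring

namespace IsLightLike

variable {η : V →ₗ[ℝ] Dual ℝ V} {e e' : T →ₗ[ℝ] V} {x : T} {β : Dual ℝ T}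
  {Y : Fin (n + 2) → T}

/-- Reads off B by evaluating on covectors built from e instead of ẽ: θ_ν = η(e Y_ν) - β(Y_ν) η(e
x), and the correction drops out. Injectivity of `starSum` and formulas for smooth coefficients both
follow. -/
theorem starSum_entry (h : IsLightLike n η e e' x β) (Ω : T [⋀^Fin (n + 3)]→ₗ[ℝ] ℝ)
    (W : Dual ℝ V [⋀^Fin (n + 4)]→ₗ[ℝ] ℝ) (κ : Dual ℝ V)
    (hne : Ω (vecCons x Y) * W (vecCons κ (vecCons (η (e x)) fun ν => η (e (Y ν)))) ≠ 0)
    (B : Matrix (Fin (n + 2)) (Fin (n + 2)) ℝ) (ν μ : Fin (n + 2)) :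
    B ν μ = (-1) ^ (ν : ℕ) * (-1) ^ (μ : ℕ) *
      (Ω (vecCons x Y) * W (vecCons κ (vecCons (η (e x)) fun ν => η (e (Y ν)))))⁻¹ *
      starSum Ω W x Y (fun ν => η (e' (Y ν))) B (ν.removeNth Y)
        (vecCons κ (vecCons (η (e x)) (μ.removeNth fun ν => η (e (Y ν))))) := by
  rw [starSum_apply_removeNth Ω W x Y _ (fun ν => η (e (Y ν))) κ (η (e x)) (fun ν => β (Y ν))
    fun ν => by rw [h.modified_apply, map_sub, map_smul]]
  have h1 : ((-1 : ℝ) ^ (ν : ℕ)) * (-1) ^ (ν : ℕ) = 1 := by rw [← mul_pow]; simp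
  have h2 : ((-1 : ℝ) ^ (μ : ℕ)) * (-1) ^ (μ : ℕ) = 1 := by rw [← mul_pow]; simp
  have h3 := inv_mul_cancel₀ hne
  generalize Ω (vecCons x Y) * W (vecCons κ (vecCons (η (e x)) fun ν => η (e (Y ν)))) = H at h3
  generalize (-1 : ℝ) ^ (ν : ℕ) = a at h1
  generalize (-1 : ℝ) ^ (μ : ℕ) = b at h2
  linear_combination (-(b * b * (H⁻¹ * H) * B ν μ)) * h1 - (H⁻¹ * H * B ν μ) * h2 - B ν μ * h3

theorem gram_zero_zero_ne_zero (h : IsLightLike n η e e' x β)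
    (hY : LinearIndependent ℝ (vecCons x Y)) : gram η e Y 0 0 ≠ 0 := fun h0 => by
  have := h.gram_definite h.null hY (Pi.single 0 1) (by simpa using h0)
  simpa using congrFun this 0

theorem linearIndependent_starSum (h : IsLightLike n η e e' x β)
    (hY : LinearIndependent ℝ (vecCons x Y)) (Ω : T [⋀^Fin (n + 3)]→ₗ[ℝ] ℝ)
    (W : Dual ℝ V [⋀^Fin (n + 4)]→ₗ[ℝ] ℝ) (κ : Dual ℝ V)
    (hne : Ω (vecCons x Y) * W (vecCons κ (vecCons (η (e x)) fun ν => η (e (Y ν)))) ≠ 0) :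
    LinearIndependent ℝ fun z : {z : Sym2 (Fin (n + 2)) // z ≠ s(0, 0)} =>
      starSum Ω W x Y (fun ν => η (e' (Y ν))) (tracelessBasis (gram η e Y) z.1) := by
  have hinj : ∀ B B', starSum Ω W x Y (fun ν => η (e' (Y ν))) B =
      starSum Ω W x Y (fun ν => η (e' (Y ν))) B' → B = B' := fun B B' hB => by
    ext ν μ
    rw [h.starSum_entry Ω W κ hne B ν μ, hB, ← h.starSum_entry Ω W κ hne B' ν μ]
  have hsum : ∀ g : {z : Sym2 (Fin (n + 2)) // z ≠ s(0, 0)} → ℝ,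
      starSum Ω W x Y (fun ν => η (e' (Y ν))) (∑ z, g z • tracelessBasis (gram η e Y) z.1) =
      ∑ z, g z • starSum Ω W x Y (fun ν => η (e' (Y ν))) (tracelessBasis (gram η e Y) z.1) :=
    fun g => by
      have hs := map_sum (starSumₗ Ω W x Y fun ν => η (e' (Y ν)))
        (fun z : {z : Sym2 (Fin (n + 2)) // z ≠ s(0, 0)} =>
          g z • tracelessBasis (gram η e Y) z.1) Finset.univ
      simp only [map_smul] at hs
      exact hs
  rw [Fintype.linearIndependent_iffₛ]
  intro f g hfg
  refine Fintype.linearIndependent_iffₛ.mp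
    (linearIndependent_tracelessBasis _ (h.gram_zero_zero_ne_zero hY)) f g (hinj _ _ ?_)
  rw [hsum, hsum]
  exact hfg

theorem eq_sum_starSum (h : IsLightLike n η e e' x β) (d : Basis (Fin (n + 3)) ℝ T)
    (hd : ⇑d = vecCons x Y) (c : Basis (Fin (n + 4)) ℝ (Dual ℝ V)) (κ : Dual ℝ V)
    (hc : ⇑c = vecCons κ (vecCons (η (e x)) fun ν => η (e (Y ν))))
    (Ω : T [⋀^Fin (n + 3)]→ₗ[ℝ] ℝ) (W : Dual ℝ V [⋀^Fin (n + 4)]→ₗ[ℝ] ℝ)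
    (hne : Ω (vecCons x Y) * W (vecCons κ (vecCons (η (e x)) fun ν => η (e (Y ν)))) ≠ 0)
    {τ : BiForm T V (n + 1) (n + 3)} (hτ : τ ∈ degeneracyFibre n η e e') :
    τ = ∑ z : {z : Sym2 (Fin (n + 2)) // z ≠ s(0, 0)},
      ((gram η e Y 0 0)⁻¹ * ((-1) ^ (z.1.out.1 : ℕ) * (-1) ^ (z.1.out.2 : ℕ) *
        (Ω (vecCons x Y) * W (vecCons κ (vecCons (η (e x)) fun ν => η (e (Y ν)))))⁻¹ *
        τ (z.1.out.1.removeNth Y) (vecCons κ (vecCons (η (e x))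
          (z.1.out.2.removeNth fun ν => η (e (Y ν))))))) •
      starSum Ω W x Y (fun ν => η (e' (Y ν))) (tracelessBasis (gram η e Y) z.1) := by
  have hΩ : Ω d ≠ 0 := hd ▸ left_ne_zero_of_mul hne
  have hW : W c ≠ 0 := hc ▸ right_ne_zero_of_mul hne
  obtain ⟨B, hB, htr, rfl⟩ := (h.mem_degeneracyFibre_iff h.null d hd c Ω hΩ W hW).mp hτ
  simp only [← h.starSum_entry Ω W κ hne B]
  have hY := hd ▸ d.linearIndependent
  have hs := congrArg (starSumₗ Ω W x Y fun ν => η (e' (Y ν)))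
    (eq_sum_tracelessBasis (gram η e Y) h.gram_isSymm (h.gram_zero_zero_ne_zero hY) B hB htr)
  rw [map_sum] at hs
  simp only [map_smul] at hs
  exact hs

theorem starSum_tracelessBasis_mem (h : IsLightLike n η e e' x β)
    (d : Basis (Fin (n + 3)) ℝ T) (c : Basis (Fin (n + 4)) ℝ (Dual ℝ V))
    (Ω : T [⋀^Fin (n + 3)]→ₗ[ℝ] ℝ) (W : Dual ℝ V [⋀^Fin (n + 4)]→ₗ[ℝ] ℝ)
    (z : Sym2 (Fin (n + 2))) :
    starSum Ω W x Y (fun ν => η (e' (Y ν))) (tracelessBasis (gram η e Y) z) ∈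
      degeneracyFibre n η e e' := by
  refine starSum_mem_degeneracyFibre d c Ω W η e e' x Y h.modified_null (fun ν => ?_) _
    (tracelessBasis_isSymm _ z) ?_
  · rw [h.metric_modified_left, h.lorentzian.symm, h.null]
  · rw [← trace_tracelessBasis_mul (gram η e Y) h.gram_isSymm z]
    simp only [Matrix.trace, Matrix.diag_apply, Matrix.mul_apply, gram, Matrix.of_apply,
      h.metric_modified_left]

end IsLightLike

end FibreBasis


/-! ### Smooth sections and smooth determinants. -/

noncomputable section SmoothFields

open Matrix (vecCons)

variable {n : ℕ} {M : Type*} [TopologicalSpace M]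
  [ChartedSpace (EuclideanSpace ℝ (Fin (n + 3))) M] [IsManifold (𝓡 (n + 3)) ∞ M]
  {F : Type*} [NormedAddCommGroup F] [NormedSpace ℝ F]
  {E : M → Type*} [TopologicalSpace (TotalSpace F E)] [∀ x, AddCommGroup (E x)]
  [∀ x, Module ℝ (E x)] [∀ x, TopologicalSpace (E x)] [∀ x, IsTopologicalAddGroup (E x)]
  [∀ x, ContinuousSMul ℝ (E x)] [FiberBundle F E] [VectorBundle ℝ F E]
  [ContMDiffVectorBundle ∞ F E (𝓡 (n + 3))]

variable (n F) in
/-- A smooth section of `E` over `U`. -/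
def IsSmoothSectionOn (U : Set M) (s : ∀ x : M, E x) : Prop :=
  ContMDiffOn (𝓡 (n + 3)) ((𝓡 (n + 3)).prod 𝓘(ℝ, F)) ∞ (fun x => TotalSpace.mk' F x (s x)) U

variable (n F) in
-- A local smooth extension is cut off by a bump function. Global sections are required because the
-- members of a local frame of 𝒮 must themselves be global elements of 𝒮.
theorem exists_isSmoothSectionOn_univ [T2Space M] (p : M) (v : E p) :
    ∃ s : ∀ x : M, E x, IsSmoothSectionOn n F Set.univ s ∧ s p = v := by
  obtain ⟨t, ht, hs⟩ := FiberBundle.exists_contMDiffOn_extend (𝓡 (n + 3)) F (k := ∞) v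
  obtain ⟨f, -, hf⟩ := (SmoothBumpFunction.nhds_basis_tsupport (I := 𝓡 (n + 3)) p).mem_iff.mp
    (interior_mem_nhds.mpr ht)
  refine ⟨fun x => f x • FiberBundle.extend F v x, ?_, ?_⟩
  · exact (ContMDiffOn.smul_section_of_tsupport f.contMDiff.contMDiffOn isOpen_interior hf
      (hs.mono interior_subset)).contMDiffOn
  · simp

theorem contMDiffOn_det {ι : Type*} [Fintype ι] [DecidableEq ι] {U : Set M}
    {A : M → Matrix ι ι ℝ}
    (h : ∀ i j, ContMDiffOn (𝓡 (n + 3)) 𝓘(ℝ, ℝ) ∞ (fun x => A x i j) U) :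
    ContMDiffOn (𝓡 (n + 3)) 𝓘(ℝ, ℝ) ∞ (fun x => (A x).det) U := by
  simp only [Matrix.det_apply']
  exact contMDiffOn_finsetSum fun σ _ => contMDiffOn_const.mul
    (contMDiffOn_finsetProd fun i _ => h _ _)

theorem contMDiffOn_oneForm_apply {U : Set M} {β : ∀ x : M, TangentSpace (𝓡 (n + 3)) x →L[ℝ] ℝ}
    (hβ : IsSmoothOneForm n M β) {Z : ∀ x : M, TangentSpace (𝓡 (n + 3)) x}
    (hZ : IsSmoothFieldOn n M U Z) :
    ContMDiffOn (𝓡 (n + 3)) 𝓘(ℝ, ℝ) ∞ (fun x => β x (Z x)) U := by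
  have h : ContMDiffOn (𝓡 (n + 3)) ((𝓡 (n + 3)).prod 𝓘(ℝ, ℝ)) ∞
      (fun x => TotalSpace.mk' ℝ (E := Bundle.Trivial M ℝ) x (β x (Z x))) U :=
    ContMDiffOn.clm_bundle_apply (F₁ := EuclideanSpace ℝ (Fin (n + 3))) hβ.contMDiffOn hZ
  intro x hx
  exact (contMDiffWithinAt_totalSpace.mp (h x hx)).2

theorem IsSmoothCovectorOn.contMDiffOn_apply {U : Set M} {α : ∀ x : M, E x →L[ℝ] ℝ}
    (hα : IsSmoothCovectorOn n F U α) {s : ∀ x : M, E x} (hs : IsSmoothSectionOn n F U s) :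
    ContMDiffOn (𝓡 (n + 3)) 𝓘(ℝ, ℝ) ∞ (fun x => α x (s x)) U := by
  have h : ContMDiffOn (𝓡 (n + 3)) ((𝓡 (n + 3)).prod 𝓘(ℝ, ℝ)) ∞
      (fun x => TotalSpace.mk' ℝ (E := Bundle.Trivial M ℝ) x (α x (s x))) U :=
    ContMDiffOn.clm_bundle_apply (F₁ := F) hα hs
  intro x hx
  exact (contMDiffWithinAt_totalSpace.mp (h x hx)).2

namespace BoundaryCoframe

variable (D : BoundaryCoframe n M F E) {U : Set M}

theorem isSmoothCovectorOn_metric {s : ∀ x : M, E x} (hs : IsSmoothSectionOn n F U s) :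
    IsSmoothCovectorOn n F U fun x => D.metric x (s x) :=
  ContMDiffOn.clm_bundle_apply (F₁ := F) (F₂ := F →L[ℝ] ℝ)
    (E₂ := fun x => E x →L[ℝ] Bundle.Trivial M ℝ x) D.metric_smooth.contMDiffOn hs

theorem isSmoothSectionOn_coframe {Z : ∀ x : M, TangentSpace (𝓡 (n + 3)) x}
    (hZ : IsSmoothFieldOn n M U Z) : IsSmoothSectionOn n F U fun x => D.coframe x (Z x) :=
  ContMDiffOn.clm_bundle_apply (F₁ := EuclideanSpace ℝ (Fin (n + 3))) D.coframe_smooth.contMDiffOn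
    hZ

theorem isLorentzian (x : M) : IsLorentzian (n + 3) (D.metricL x) :=
  D.metric_lorentzian x

end BoundaryCoframe

theorem NullFrame.isLightLike {D : BoundaryCoframe n M F E} (R : NullFrame D)
    {β : ∀ x : M, TangentSpace (𝓡 (n + 3)) x →L[ℝ] ℝ} (hβ : R.IsNormalising β) (x : M) :
    IsLightLike n (D.metricL x) (D.coframeL x) (R.modifiedCoframe β x) (R.X x)
      (β x : TangentSpace (𝓡 (n + 3)) x →ₗ[ℝ] ℝ) where
  lorentzian := D.isLorentzian x
  injective := D.coframe_injective x
  null u := R.X_null x u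
  apply_null := hβ.apply_X x
  modified_apply _ := rfl

section DualDet

variable {T V : Type*} [AddCommGroup T] [Module ℝ T] [AddCommGroup V] [Module ℝ V]

/-- The alternating form `ξ ↦ det (ξ_i (v_j))` on the dual space. -/
def dualDet {m : ℕ} (v : Fin m → V) : Dual ℝ V [⋀^Fin m]→ₗ[ℝ] ℝ :=
  Matrix.detRowAlternating.compLinearMap (LinearMap.pi fun j => Dual.eval ℝ V (v j))

theorem dualDet_apply {m : ℕ} (v : Fin m → V) (ξ : Fin m → Dual ℝ V) :
    dualDet v ξ = (Matrix.of fun i j => ξ i (v j)).det := rfl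

/-- The pullback of `ι_κ W` along a linear map. -/
def pullbackForm {m : ℕ} (W : Dual ℝ V [⋀^Fin (m + 1)]→ₗ[ℝ] ℝ) (κ : Dual ℝ V)
    (f : T →ₗ[ℝ] Dual ℝ V) : T [⋀^Fin m]→ₗ[ℝ] ℝ :=
  (W.curryLeft κ).compLinearMap f

theorem pullbackForm_apply {m : ℕ} (W : Dual ℝ V [⋀^Fin (m + 1)]→ₗ[ℝ] ℝ) (κ : Dual ℝ V)
    (f : T →ₗ[ℝ] Dual ℝ V) (u : Fin m → T) :
    pullbackForm W κ f u = W (vecCons κ fun i => f (u i)) := rfl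

end DualDet

end SmoothFields


/-! ### The smooth local frame of 𝒮. -/

noncomputable section LocalFrame

open Matrix (vecCons)

theorem IsLorentzian.det_ne_zero {V : Type*} [AddCommGroup V] [Module ℝ V] {m : ℕ}
    {η : V →ₗ[ℝ] Dual ℝ V} (h : IsLorentzian m η) {ι : Type*} [Fintype ι] [DecidableEq ι]
    (v : Basis ι ℝ V) : (Matrix.of fun i j => η (v i) (v j)).det ≠ 0 := fun h0 => by
  obtain ⟨a, ha, ha0⟩ := Matrix.exists_vecMul_eq_zero_iff.mpr h0
  have h1 : ∑ i, a i • v i = 0 := by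
    refine h.eq_zero fun w => ?_
    have : η (∑ i, a i • v i) = 0 := by
      refine v.ext fun j => ?_
      have := congrFun ha0 j
      simpa [Matrix.vecMul, dotProduct] using this
    rw [this, LinearMap.zero_apply]
  exact ha (funext fun i => Fintype.linearIndependent_iff.mp v.linearIndependent a h1 i)

theorem linearIndependent_of_dualDet_ne_zero {V : Type*} [AddCommGroup V] [Module ℝ V] {m : ℕ}
    {v : Fin m → V} {ξ : Fin m → Dual ℝ V} (h : dualDet v ξ ≠ 0) : LinearIndependent ℝ ξ := by
  by_contra h0
  exact h ((dualDet v).map_linearDependent ξ h0)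

variable {n : ℕ} {M : Type*} [TopologicalSpace M]
  [ChartedSpace (EuclideanSpace ℝ (Fin (n + 3))) M] [IsManifold (𝓡 (n + 3)) ∞ M]
  {F : Type*} [NormedAddCommGroup F] [NormedSpace ℝ F]
  {E : M → Type*} [TopologicalSpace (TotalSpace F E)] [∀ x, AddCommGroup (E x)]
  [∀ x, Module ℝ (E x)] [∀ x, TopologicalSpace (E x)] [∀ x, IsTopologicalAddGroup (E x)]
  [∀ x, ContinuousSMul ℝ (E x)] [FiberBundle F E] [VectorBundle ℝ F E]
  [ContMDiffVectorBundle ∞ F E (𝓡 (n + 3))]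

theorem contMDiffOn_dualDet {m : ℕ} {U : Set M} {s : Fin m → ∀ x : M, E x}
    (hs : ∀ j, IsSmoothSectionOn n F U (s j)) {α : Fin m → ∀ x : M, E x →L[ℝ] ℝ}
    (hα : ∀ i, IsSmoothCovectorOn n F U (α i)) :
    ContMDiffOn (𝓡 (n + 3)) 𝓘(ℝ, ℝ) ∞
      (fun x => dualDet (fun j => s j x) fun i => (α i x : E x →ₗ[ℝ] ℝ)) U :=
  contMDiffOn_det fun i j => (hα i).contMDiffOn_apply (hs j)

theorem finrank_tangentSpace_eq (x : M) : finrank ℝ (TangentSpace (𝓡 (n + 3)) x) = n + 3 := by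
  change finrank ℝ (EuclideanSpace ℝ (Fin (n + 3))) = n + 3
  simp

namespace NullFrame

variable {D : BoundaryCoframe n M F E} (R : NullFrame D)

/-- The frame as a basis of each tangent space. -/
def tangentBasis (x : M) : Basis (Fin (n + 3)) ℝ (TangentSpace (𝓡 (n + 3)) x) :=
  basisOfLinearIndependentOfCardEqFinrank (R.frame x)
    (by rw [finrank_tangentSpace_eq, Fintype.card_fin])

theorem coe_tangentBasis (x : M) :
    ⇑(R.tangentBasis x) = vecCons (R.X x) fun i => R.Y i x :=
  coe_basisOfLinearIndependentOfCardEqFinrank _ _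

/-- The covector fields `η(s₀)`, `η(e X)`, `η(e Y₁)`, …, `η(e Y_{N-2})`. -/
def covectorFrame (s : ∀ x : M, E x) (x : M) : Fin (n + 4) → Dual ℝ (E x) :=
  vecCons (D.metricL x (s x)) (vecCons (D.metricL x (D.coframeL x (R.X x)))
    fun ν => D.metricL x (D.coframeL x (R.Y ν x)))

variable (s : Fin (n + 4) → ∀ x : M, E x)

/-- The form `(u₁, …, u_{N-1}) ↦ det (η(s₀), η(e u₁), …, η(e u_{N-1}))` on the tangent space. -/
def tangentVolume (x : M) : TangentSpace (𝓡 (n + 3)) x [⋀^Fin (n + 3)]→ₗ[ℝ] ℝ :=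
  pullbackForm (dualDet fun j => s j x) (D.metricL x (s 0 x)) (D.metricL x ∘ₗ D.coframeL x)

/-- Because the volume on the tangent space is pulled back from the internal one, nonvanishing of a
single determinant controls both. -/
theorem tangentVolume_frame (x : M) : tangentVolume (D := D) s x
    (vecCons (R.X x) fun i => R.Y i x) = dualDet (fun j => s j x) (R.covectorFrame (s 0) x) := by
  rw [tangentVolume, pullbackForm_apply]
  congr 2
  funext i
  exact Fin.cases rfl (fun _ => rfl) i

/-- Local frame of `𝒮`. -/
def localFrame (β : ∀ x : M, TangentSpace (𝓡 (n + 3)) x →L[ℝ] ℝ) (z : Sym2 (Fin (n + 2)))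
    (x : M) : BiForm (TangentSpace (𝓡 (n + 3)) x) (E x) (n + 1) (n + 3) :=
  starSum (tangentVolume (D := D) s x) (dualDet fun j => s j x) (R.X x) (fun i => R.Y i x)
    (fun ν => D.metricL x (R.modifiedCoframe β x (R.Y ν x)))
    (tracelessBasis (IsLightLike.gram (D.metricL x) (D.coframeL x) fun i => R.Y i x) z)

variable {R s} {U : Set M} {β : ∀ x : M, TangentSpace (𝓡 (n + 3)) x →L[ℝ] ℝ}

theorem isSmoothCovectorOn_metric_coframe {Z : ∀ x : M, TangentSpace (𝓡 (n + 3)) x}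
    (hZ : IsSmoothFieldOn n M U Z) :
    IsSmoothCovectorOn n F U fun x => D.metric x (D.coframe x (Z x)) :=
  D.isSmoothCovectorOn_metric (D.isSmoothSectionOn_coframe hZ)

theorem contMDiffOn_tangentVolume (hs : ∀ j, IsSmoothSectionOn n F U (s j))
    {Z : Fin (n + 3) → ∀ x : M, TangentSpace (𝓡 (n + 3)) x}
    (hZ : ∀ a, IsSmoothFieldOn n M U (Z a)) :
    ContMDiffOn (𝓡 (n + 3)) 𝓘(ℝ, ℝ) ∞
      (fun x => tangentVolume (D := D) s x fun a => Z a x) U := by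
  have h := contMDiffOn_dualDet hs (α := Fin.cons (fun x => D.metric x (s 0 x))
    fun a x => D.metric x (D.coframe x (Z a x))) fun i => by
      refine Fin.cases ?_ (fun a => ?_) i
      · exact D.isSmoothCovectorOn_metric (hs 0)
      · exact isSmoothCovectorOn_metric_coframe (hZ a)
  refine h.congr fun x _ => ?_
  rw [tangentVolume, pullbackForm_apply]
  congr 1
  funext i
  exact Fin.cases rfl (fun _ => rfl) i

theorem contMDiffOn_gram (i j : Fin (n + 2)) :
    ContMDiffOn (𝓡 (n + 3)) 𝓘(ℝ, ℝ) ∞ (fun x => IsLightLike.gram (D.metricL x) (D.coframeL x)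
      (fun i => R.Y i x) i j) U :=
  (isSmoothCovectorOn_metric_coframe ((R.Y_smooth i).mono (Set.subset_univ U))).contMDiffOn_apply
    (D.isSmoothSectionOn_coframe ((R.Y_smooth j).mono (Set.subset_univ U)))

theorem contMDiffOn_tracelessBasis (z : Sym2 (Fin (n + 2))) (i j : Fin (n + 2)) :
    ContMDiffOn (𝓡 (n + 3)) 𝓘(ℝ, ℝ) ∞ (fun x => tracelessBasis
      (IsLightLike.gram (D.metricL x) (D.coframeL x) fun i => R.Y i x) z i j) U := by
  simp only [tracelessBasis, Matrix.of_apply]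
  refine ContMDiffOn.sub ?_ ?_
  · split_ifs
    · exact contMDiffOn_gram 0 0
    · exact contMDiffOn_const
  · split_ifs
    · refine contMDiffOn_finsetSum fun a _ => contMDiffOn_finsetSum fun b _ => ?_
      split_ifs
      · exact contMDiffOn_gram a b
      · exact contMDiffOn_const
    · exact contMDiffOn_const

theorem isSmoothBiForm_localFrame (hβ : R.IsNormalising β)
    (hs : ∀ j, IsSmoothSectionOn n F Set.univ (s j)) (z : Sym2 (Fin (n + 2))) :
    IsSmoothBiForm n F (R.localFrame s β z) := by
  intro U _ Z hZ α hα
  have hs' := fun j => (hs j).mono (Set.subset_univ U)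
  have hX : IsSmoothFieldOn n M U R.X := R.X_smooth.mono (Set.subset_univ U)
  have hY := fun ν => (R.Y_smooth ν).mono (Set.subset_univ U)
  simp only [localFrame, starSum_apply]
  refine contMDiffOn_finsetSum fun j _ => contMDiffOn_finsetSum fun ν _ => ?_
  refine (contMDiffOn_tracelessBasis z j ν).mul (ContMDiffOn.mul ?_ ?_)
  · refine (contMDiffOn_tangentVolume (D := D) hs' (Z := Fin.cons R.X (Fin.cons (R.Y j) Z))
      fun i => ?_).congr fun x _ => ?_
    · exact Fin.cases hX (fun i => Fin.cases (hY j) hZ i) i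
    · congr 1
      funext i
      exact Fin.cases rfl (fun i => Fin.cases rfl (fun _ => rfl) i) i
  · have hm : IsSmoothSectionOn n F U
        fun x => D.coframe x (R.Y ν x) - β x (R.Y ν x) • D.coframe x (R.X x) :=
      ContMDiffOn.sub_section (D.isSmoothSectionOn_coframe (hY ν))
        ((contMDiffOn_oneForm_apply hβ.smooth (hY ν)).smul_section
          (D.isSmoothSectionOn_coframe hX))
    refine (contMDiffOn_dualDet hs' (α := Fin.cons
      (fun x => D.metric x (D.coframe x (R.Y ν x) - β x (R.Y ν x) • D.coframe x (R.X x))) α)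
      fun i => ?_).congr fun x _ => ?_
    · exact Fin.cases (D.isSmoothCovectorOn_metric hm) hα i
    · congr 1
      funext i
      exact Fin.cases rfl (fun _ => rfl) i

theorem localFrame_mem (hβ : R.IsNormalising β) (z : Sym2 (Fin (n + 2))) (x : M) :
    R.localFrame s β z x ∈ R.fibreS β x := by
  obtain ⟨b, -⟩ := D.isLorentzian x
  exact (R.isLightLike hβ x).starSum_tracelessBasis_mem (R.tangentBasis x) b.dualBasis _ _ z

section Pointwise

variable {x : M}

theorem tangentVolume_mul_ne_zero
    (hx : dualDet (fun j => s j x) (R.covectorFrame (s 0) x) ≠ 0) :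
    tangentVolume (D := D) s x (vecCons (R.X x) fun i => R.Y i x) *
      dualDet (fun j => s j x) (R.covectorFrame (s 0) x) ≠ 0 := by
  rw [R.tangentVolume_frame]
  exact mul_ne_zero hx hx

theorem linearIndependent_localFrame (hβ : R.IsNormalising β)
    (hx : dualDet (fun j => s j x) (R.covectorFrame (s 0) x) ≠ 0) :
    LinearIndependent ℝ fun z : {z : Sym2 (Fin (n + 2)) // z ≠ s(0, 0)} =>
      R.localFrame s β z.1 x :=
  (R.isLightLike hβ x).linearIndependent_starSum (R.frame x) _ _ _ (tangentVolume_mul_ne_zero hx)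

variable (R s) in
/-- The coefficients of an element of `𝒮` with respect to the local frame. -/
def localCoeff (τ : BiForm (TangentSpace (𝓡 (n + 3)) x) (E x) (n + 1) (n + 3))
    (z : Sym2 (Fin (n + 2))) : ℝ :=
  (IsLightLike.gram (D.metricL x) (D.coframeL x) (fun i => R.Y i x) 0 0)⁻¹ *
    ((-1) ^ (z.out.1 : ℕ) * (-1) ^ (z.out.2 : ℕ) *
      (tangentVolume (D := D) s x (vecCons (R.X x) fun i => R.Y i x) *
        dualDet (fun j => s j x) (R.covectorFrame (s 0) x))⁻¹ *
      τ (z.out.1.removeNth fun i => R.Y i x) (vecCons (D.metricL x (s 0 x))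
        (vecCons (D.metricL x (D.coframeL x (R.X x)))
          (z.out.2.removeNth fun ν => D.metricL x (D.coframeL x (R.Y ν x))))))

theorem eq_sum_localFrame (hβ : R.IsNormalising β)
    (hx : dualDet (fun j => s j x) (R.covectorFrame (s 0) x) ≠ 0)
    {τ : BiForm (TangentSpace (𝓡 (n + 3)) x) (E x) (n + 1) (n + 3)} (hτ : τ ∈ R.fibreS β x) :
    τ = ∑ z : {z : Sym2 (Fin (n + 2)) // z ≠ s(0, 0)},
      R.localCoeff s τ z.1 • R.localFrame s β z.1 x := by
  have hf : finrank ℝ (E x) = n + 4 := by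
    obtain ⟨b, -⟩ := D.isLorentzian x
    rw [finrank_eq_card_basis b, Fintype.card_fin]
  have : Module.Finite ℝ (E x) := Module.finite_of_finrank_pos (by omega)
  let c := basisOfLinearIndependentOfCardEqFinrank (linearIndependent_of_dualDet_ne_zero hx)
    (by rw [Subspace.dual_finrank_eq, hf, Fintype.card_fin])
  exact (R.isLightLike hβ x).eq_sum_starSum (R.tangentBasis x) (R.coe_tangentBasis x) c _
    (coe_basisOfLinearIndependentOfCardEqFinrank _ _) _ _ (tangentVolume_mul_ne_zero hx) hτ

end Pointwise

theorem contMDiffOn_dualDet_covectorFrame (hs : ∀ j, IsSmoothSectionOn n F U (s j)) :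
    ContMDiffOn (𝓡 (n + 3)) 𝓘(ℝ, ℝ) ∞
      (fun x => dualDet (fun j => s j x) (R.covectorFrame (s 0) x)) U := by
  refine (contMDiffOn_dualDet hs (α := Fin.cons (fun x => D.metric x (s 0 x))
    (Fin.cons (fun x => D.metric x (D.coframe x (R.X x)))
      fun ν x => D.metric x (D.coframe x (R.Y ν x)))) fun i => ?_).congr fun x _ => ?_
  · refine Fin.cases (D.isSmoothCovectorOn_metric (hs 0)) (fun i => Fin.cases ?_ (fun i => ?_) i) i
    · exact isSmoothCovectorOn_metric_coframe (R.X_smooth.mono (Set.subset_univ U))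
    · exact isSmoothCovectorOn_metric_coframe ((R.Y_smooth i).mono (Set.subset_univ U))
  · congr 1
    funext i
    exact Fin.cases rfl (fun i => Fin.cases rfl (fun _ => rfl) i) i

/-- The coefficients are values of τ on smooth fields, divided by G₀₀ and by the square of the
determinant, which do not vanish on U. -/
theorem contMDiffOn_localCoeff (hβ : R.IsNormalising β) (hU : IsOpen U)
    (hs : ∀ j, IsSmoothSectionOn n F Set.univ (s j))
    (hx : ∀ x ∈ U, dualDet (fun j => s j x) (R.covectorFrame (s 0) x) ≠ 0)
    {τ : ∀ x : M, BiForm (TangentSpace (𝓡 (n + 3)) x) (E x) (n + 1) (n + 3)}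
    (hτ : IsSmoothBiForm n F τ) (z : Sym2 (Fin (n + 2))) :
    ContMDiffOn (𝓡 (n + 3)) 𝓘(ℝ, ℝ) ∞ (fun x => R.localCoeff s (τ x) z) U := by
  have hs' := fun j => (hs j).mono (Set.subset_univ U)
  have hX : IsSmoothFieldOn n M U R.X := R.X_smooth.mono (Set.subset_univ U)
  have hY := fun ν => (R.Y_smooth ν).mono (Set.subset_univ U)
  unfold localCoeff
  refine ContMDiffOn.mul ?_ (ContMDiffOn.mul (contMDiffOn_const.mul ?_) ?_)
  · exact (contMDiffOn_gram 0 0).inv₀ fun x _ =>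
      (R.isLightLike hβ x).gram_zero_zero_ne_zero (R.frame x)
  · simp only [R.tangentVolume_frame]
    exact ((contMDiffOn_dualDet_covectorFrame hs').mul
      (contMDiffOn_dualDet_covectorFrame hs')).inv₀ fun x h => mul_ne_zero (hx x h) (hx x h)
  · refine (hτ U hU (fun i => R.Y (z.out.1.succAbove i)) (fun i => hY _)
      (Fin.cons (fun x => D.metric x (s 0 x))
        (Fin.cons (fun x => D.metric x (D.coframe x (R.X x)))
          fun ν x => D.metric x (D.coframe x (R.Y (z.out.2.succAbove ν) x))))
      fun i => ?_).congr fun x _ => ?_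
    · refine Fin.cases (D.isSmoothCovectorOn_metric (hs' 0))
        (fun i => Fin.cases ?_ (fun i => ?_) i) i
      · exact isSmoothCovectorOn_metric_coframe hX
      · exact isSmoothCovectorOn_metric_coframe (hY _)
    · congr 1
      funext i
      exact Fin.cases rfl (fun i => Fin.cases rfl (fun _ => rfl) i) i

variable (R) in
/-- Near every point there are sections for which the local frame is a frame. -/
theorem exists_dualDet_covectorFrame_ne_zero [T2Space M] (p : M) :
    ∃ s : Fin (n + 4) → ∀ x : M, E x, (∀ j, IsSmoothSectionOn n F Set.univ (s j)) ∧
      dualDet (fun j => s j p) (R.covectorFrame (s 0) p) ≠ 0 := by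
  have hf : finrank ℝ (E p) = n + 4 := by
    obtain ⟨b, -⟩ := D.isLorentzian p
    rw [finrank_eq_card_basis b, Fintype.card_fin]
  have : Module.Finite ℝ (E p) := Module.finite_of_finrank_pos (by omega)
  have hli : LinearIndependent ℝ fun i => D.coframeL p (R.tangentBasis p i) :=
    (R.tangentBasis p).linearIndependent.map' _ (LinearMap.ker_eq_bot.mpr (D.coframe_injective p))
  -- One vector completes the image of e to a basis at p. For sections through this basis the
  -- determinant at p is that of the Gram matrix of η, nonzero by nondegeneracy.
  obtain ⟨k, hk⟩ := exists_linearIndependent_cons_of_lt_finrank hli (by omega)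
  let v := basisOfLinearIndependentOfCardEqFinrank hk (by rw [hf, Fintype.card_fin])
  have hv : ⇑v = Fin.cons k fun i => D.coframeL p (R.tangentBasis p i) :=
    coe_basisOfLinearIndependentOfCardEqFinrank _ _
  choose s hs hsp using fun j => exists_isSmoothSectionOn_univ n F p (v j)
  refine ⟨s, hs, ?_⟩
  have h := (D.isLorentzian p).det_ne_zero v
  convert h using 1
  rw [dualDet_apply]
  congr 2
  funext i j
  rw [hsp]
  have : R.covectorFrame (s 0) p i = D.metricL p (v i) := by
    rw [hv, R.coe_tangentBasis]
    refine Fin.cases ?_ (fun i => Fin.cases rfl (fun _ => rfl) i) i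
    change D.metricL p (s 0 p) = _
    rw [hsp, hv]
    rfl
  rw [this]

theorem isLocallyFreeOfRank_spaceS [T2Space M] (hβ : R.IsNormalising β) :
    IsLocallyFreeOfRank (R.spaceS β) ((n + 4) * (n + 1) / 2) := by
  intro p
  obtain ⟨s, hs, hp⟩ := R.exists_dualDet_covectorFrame_ne_zero p
  let ε := (Fintype.equivFinOfCardEq (card_sym2_ne n)).symm
  have hcont : Continuous fun x => dualDet (fun j => s j x) (R.covectorFrame (s 0) x) :=
    continuousOn_univ.mp (contMDiffOn_dualDet_covectorFrame hs).continuousOn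
  have hU := isOpen_ne_fun hcont (continuous_const (y := (0 : ℝ)))
  refine ⟨{x | dualDet (fun j => s j x) (R.covectorFrame (s 0) x) ≠ 0}, hU, hp,
    fun k => R.localFrame s β (ε k).1, fun k => ⟨isSmoothBiForm_localFrame hβ hs _,
      localFrame_mem hβ _⟩, fun x hx => ?_, fun τ hτ => ?_⟩
  · exact (linearIndependent_localFrame hβ hx).comp ε ε.injective
  · refine ⟨fun k x => R.localCoeff s (τ x) (ε k).1, fun k =>
      contMDiffOn_localCoeff hβ hU hs (fun x hx => hx) hτ.1 _, fun x hx => ?_⟩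
    rw [ε.sum_comp fun z => R.localCoeff s (τ x) z.1 • R.localFrame s β z.1 x]
    exact eq_sum_localFrame hβ hx (hτ.2 x)

theorem finrank_fibreS [T2Space M] (hβ : R.IsNormalising β) (x : M) :
    finrank ℝ (R.fibreS β x) = (n + 4) * (n + 1) / 2 := by
  obtain ⟨s, -, hx⟩ := R.exists_dualDet_covectorFrame_ne_zero x
  have hspan : Submodule.span ℝ (Set.range fun z : {z : Sym2 (Fin (n + 2)) // z ≠ s(0, 0)} =>
      R.localFrame s β z.1 x) = R.fibreS β x := by
    refine le_antisymm (Submodule.span_le.mpr ?_) fun τ hτ => ?_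
    · rintro _ ⟨z, rfl⟩
      exact localFrame_mem hβ _ _
    · rw [eq_sum_localFrame hβ hx hτ]
      exact Submodule.sum_mem _ fun z _ =>
        Submodule.smul_mem _ _ (Submodule.subset_span ⟨z, rfl⟩)
  rw [← hspan, finrank_span_eq_card (linearIndependent_localFrame hβ hx), card_sym2_ne]

end NullFrame

end LocalFrame


/-! ### Assembly of the theorem. -/

theorem linearIndependent_vecCons_last {V : Type*} [AddCommGroup V] [Module ℝ V] {m : ℕ}
    {d : Fin (m + 1) → V} (hd : LinearIndependent ℝ d) :
    LinearIndependent ℝ (Matrix.vecCons (d (Fin.last m)) fun j : Fin m => d j.castSucc) := by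
  convert hd.comp _ (finRotate (m + 1)).symm.injective using 1
  funext i
  refine Fin.cases ?_ (fun i => ?_) i
  · rw [Function.comp_apply, (Equiv.symm_apply_eq _).mpr (finRotate_last (n := m)).symm]
    rfl
  · rw [Function.comp_apply, (Equiv.symm_apply_eq _ (y := i.castSucc)).mpr]
    · rfl
    · rw [finRotate_apply]
      exact Fin.coeSucc_eq_succ.symm

theorem mainTheorem4 (n : ℕ) :
    ∃ f : Matrix (Fin (n + 3)) (Fin (n + 3)) ℝ → Fin (n + 2) → Fin (n + 2) →
        ((({p : Fin (n + 2) × Fin (n + 2) // p.1 < p.2} → ℝ) × (Fin (n + 2) → ℝ)) →ₗ[ℝ] ℝ),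
    ∀ (M : Type*) [TopologicalSpace M] [T2Space M]
      [ChartedSpace (EuclideanSpace ℝ (Fin (n + 3))) M] [IsManifold (𝓡 (n + 3)) ∞ M]
      (F : Type*) [NormedAddCommGroup F] [NormedSpace ℝ F]
      (E : M → Type*) [TopologicalSpace (TotalSpace F E)] [∀ x, AddCommGroup (E x)]
      [∀ x, Module ℝ (E x)] [∀ x, TopologicalSpace (E x)] [∀ x, IsTopologicalAddGroup (E x)]
      [∀ x, ContinuousSMul ℝ (E x)] [FiberBundle F E] [VectorBundle ℝ F E]
      [ContMDiffVectorBundle ∞ F E (𝓡 (n + 3))]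
      (D : BoundaryCoframe n M F E) (R : NullFrame D)
      (β : ∀ x : M, TangentSpace (𝓡 (n + 3)) x →L[ℝ] ℝ), R.IsNormalising β →
      -- the rank of `𝒮` is `N (N - 3) / 2`
      IsLocallyFreeOfRank (R.spaceS β) ((n + 4) * (n + 1) / 2) ∧
      (∀ x, Module.finrank ℝ (R.fibreS β x) = (n + 4) * (n + 1) / 2) ∧
      -- the components of the elements of `𝒮` at a point `q` in local coordinates
      ∀ φ ∈ IsManifold.maximalAtlas (𝓡 (n + 3)) ∞ M, ∀ q ∈ φ.source,
        D.IsNull q (coordVector φ q (Fin.last (n + 2))) →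
        ∀ b : Module.Basis (Fin (n + 4)) ℝ (E q),
          (∀ i : Fin (n + 3), b i.castSucc = D.coframe q (coordVector φ q i)) →
          (∀ u, D.metric q (b (Fin.last (n + 3))) (R.modifiedCoframe β q u) = 0) →
          ∀ τ : BiForm (TangentSpace (𝓡 (n + 3)) q) (E q) (n + 1) (n + 3),
            τ ∈ R.fibreS β q ↔
              (∀ I J, component (coordVector φ q) b τ I J ≠ 0 → IsXYIndex I J) ∧
              ∑ μ, compY (coordVector φ q) b τ μ = 0 ∧
              ∀ μ₁ μ₂ : Fin (n + 2), μ₁ < μ₂ →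
                compX (coordVector φ q) b τ μ₁ μ₂ =
                  f (R.modifiedMetric β q (coordVector φ q)) μ₁ μ₂
                    (fun p => compX (coordVector φ q) b τ p.1.2 p.1.1,
                      compY (coordVector φ q) b τ) := by
  -- The functions are chosen before any geometric data, as a function of the matrix alone.
  choose f hf using fun g : Matrix (Fin (n + 2)) (Fin (n + 2)) ℝ => exists_triangular_completion g
  refine ⟨fun G => f (G.submatrix Fin.castSucc Fin.castSucc), ?_⟩
  intro M _ _ _ _ F _ _ E _ _ _ _ _ _ _ _ _ D R β hβ
  refine ⟨NullFrame.isLocallyFreeOfRank_spaceS hβ, NullFrame.finrank_fibreS hβ, ?_⟩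
  intro φ _ q _ hnull b hb hbl τ
  have h := R.isLightLike hβ q
  -- Only the block of g̃ without the null direction enters; there it agrees with the Gram matrix of
  -- e.
  have hG : (R.modifiedMetric β q (coordVector φ q)).submatrix Fin.castSucc Fin.castSucc =
      IsLightLike.gram (D.metricL q) (D.coframeL q) fun j => coordVector φ q j.castSucc := by
    ext i j
    exact h.metric_modified _ _
  have hli : LinearIndependent ℝ (coordVector φ q) := by
    refine LinearIndependent.of_comp (D.coframeL q) ?_
    have := b.linearIndependent.comp Fin.castSucc (Fin.castSucc_injective _)
    convert this using 1
    funext i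
    exact (hb i).symm
  refine h.mem_degeneracyFibre_iff_component (finrank_tangentSpace_eq q) (coordVector φ q) b hb
    hnull hbl _ (fun Z => ?_) τ
  beta_reduce
  rw [hG]
  exact hf _ h.gram_isSymm (h.gram_definite hnull (linearIndependent_vecCons_last hli)) Z
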